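/- Let a (finite-dimensional, real) Lie group $G$ with Lie algebra $\mathfrak g$ act smoothly on a smooth manifold $M$. For $x\in\mathfrak g$ let $v_x$ be the infinitesimal generator, $v_x(p)=\frac{d}{dt}\big|_{0}\exp(-tx)\cdot p$, so that $x\mapsto v_x$ is a Lie algebra homomorphism. Write $\iota(v_1\wedge\dots\wedge v_k)\sigma=\sigma(v_1,\dots,v_k,\cdot,\dots,\cdot)$ and $\varsigma(k)=-(-1)^{k(k+1)/2}$. Let $\Omega(M)^G$ be the $G$-invariant differential forms with the de Rham differential $d$, and let $\mathcal C=\wedge^{\ge1}\mathfrak g^*\otimes\Omega(M)$ with total degree and differential $d_{tot}$, acting on $\wedge^k\mathfrak g^*\otimes\Omega(M)$ as $d_{\mathfrak g}+(-1)^kd$, where $$(d_{\mathfrak g}\varphi)(x_1,\dots,x_{k+1})=\sum_{1\le i<j\le k+1}(-1)^{i+j}\varphi([x_i,x_j],x_1,\dots,\widehat{x_i},\dots,\widehat{x_j},\dots,x_{k+1}).$$ For $\sigma\in\Omega^N(M)^G$ put $\sigma_k(x_1,\dots,x_k)=\iota(v_{x_1}\wedge\dots\wedge v_{x_k})\sigma$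 and $\widetilde\sigma=\sum_{k=1}^N(-1)^{k-1}\sigma_k\in\mathcal C$. Let $$\mathcal B=\Omega(M)^G[1]\oplus\mathcal C,\qquad D(\sigma[1],\varphi)=(d\sigma[1],\ \widetilde\sigma-d_{tot}\varphi),$$ so $\mathcal B^n=\Omega^{n+1}(M)^G\oplus\mathcal C^n$ for $n\in\mathbb Z$. Then $(\mathcal B,D)$ is a complex, i.e. $D\circ D=0$. Moreover, for every integer $n\ge0$, every $\omega\in\Omega^{n+1}(M)^G$ and every $\varphi=\varphi_1+\dots+\varphi_n\in\mathcal C^n$ with $\varphi_k\in\wedge^k\mathfrak g^*\otimes\Omega^{n-k}(M)$, the element $(\omega[1],\varphi)$ of $\mathcal B^n$ is $D$-closed if and only if $d\omega=0$ and the maps $f_k:=\varsigma(k)\varphi_k\colon\wedge^k\mathfrak g\to\Omega^{n-k}(M)$, $1\le k\le n$, are the components of a homotopy moment map for the action of $G$ on $(M,\omega)$, that is: $d(f_1(x))=-\iota(v_x)\omega$ for $x\in\mathfrak g$ (if $n\ge1$); for $2\le k\le n$ $$\sum_{1\le i<j\le k}(-1)^{i+j+1}f_{k-1}([x_i,x_j],x_1,\dots,\widehat{x_i},\dots,\widehat{x_j},\dots,x_k)=df_k(x_1,\dots,x_k)+\varsigma(k)\,\iota(v_{x_1}\wedge\dots\wedge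 v_{x_k})\omega;$$ and $$\sum_{1\le i<j\le n+1}(-1)^{i+j+1}f_n([x_i,x_j],x_1,\dots,\widehat{x_i},\dots,\widehat{x_j},\dots,x_{n+1})=\varsigma(n+1)\,\iota(v_{x_1}\wedge\dots\wedge v_{x_{n+1}})\omega$$ (for $n=0$ the left-hand side is the empty sum). -/

import Mathlib

open scoped Manifold ContDiff Topology

set_option linter.unusedSectionVars false

noncomputable section

namespace HomotopyMoment

section Forms

variable {E : Type*} [NormedAddCommGroup E] [NormedSpace ℝ E]
  {M : Type*} [TopologicalSpace M] [ChartedSpace E M]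
  {F : Type*} [NormedAddCommGroup F] [NormedSpace ℝ F]
  {N : Type*} [TopologicalSpace N] [ChartedSpace F N]

variable (E M) in
/-- Not necessarily smooth differential `k`-forms on `M`: a `k`-linear alternating form on each
tangent space. -/
abbrev RawForm (k : ℕ) : Type _ := ∀ p : M, TangentSpace 𝓘(ℝ, E) p [⋀^Fin k]→L[ℝ] ℝ

/-- The pullback `f^* σ` along a map `f : M → N`. -/
def rawPullback (f : M → N) {k : ℕ} (σ : RawForm F N k) : RawForm E M k := fun p ↦
  (σ (f p)).compContinuousLinearMap (mfderiv 𝓘(ℝ, E) 𝓘(ℝ, F) f p)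

/-- The expression of a form in the preferred chart `φ` at `x₀`: the pullback of the form along
`φ⁻¹`, as a form on the model space. It is meaningful on the target of the chart. -/
def localRep {k : ℕ} (x₀ : M) (σ : RawForm E M k) : E → E [⋀^Fin k]→L[ℝ] ℝ := fun y ↦
  ContinuousAlternatingMap.compContinuousLinearMap (M := E) (M' := E)
    (σ ((extChartAt 𝓘(ℝ, E) x₀).symm y))
    (mfderiv 𝓘(ℝ, E) 𝓘(ℝ, E) (extChartAt 𝓘(ℝ, E) x₀).symm y)

/-- A form is smooth if all its chart expressions are. -/
def IsSmoothForm {k : ℕ} (σ : RawForm E M k) : Prop :=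
  ∀ x₀ : M, ContDiffOn ℝ ∞ (localRep x₀ σ) (extChartAt 𝓘(ℝ, E) x₀).target

lemma localRep_add {k : ℕ} (x₀ : M) (σ η : RawForm E M k) :
    localRep x₀ (σ + η) = localRep x₀ σ + localRep x₀ η := rfl

lemma localRep_smul {k : ℕ} (x₀ : M) (c : ℝ) (σ : RawForm E M k) :
    localRep x₀ (c • σ) = c • localRep x₀ σ := rfl

lemma localRep_zero {k : ℕ} (x₀ : M) :
    localRep x₀ (0 : RawForm E M k) = 0 := rfl

variable (E M) in
/-- The subspace of smooth differential `k`-forms on `M`. -/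
def smoothForms (k : ℕ) : Submodule ℝ (RawForm E M k) where
  carrier := {σ | IsSmoothForm σ}
  add_mem' := fun ha hb x₀ ↦ (ha x₀).add (hb x₀)
  zero_mem' := fun _ ↦ contDiffOn_const (c := 0)
  smul_mem' := fun c _ ha x₀ ↦ (ha x₀).const_smul c

variable (E M) in
/-- `Ω^k(M)`: the real vector space of smooth differential `k`-forms on `M`. -/
def Form (k : ℕ) : Type _ := ↥(smoothForms E M k)

instance instAddCommGroupForm (k : ℕ) : AddCommGroup (Form E M k) := inferInstanceAs (AddCommGroup ↥(smoothForms E M k))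

instance instModuleForm (k : ℕ) : Module ℝ (Form E M k) := inferInstanceAs (Module ℝ ↥(smoothForms E M k))

/-- The exterior derivative in the preferred chart `φ` at `x₀`: `φ^* d ((φ⁻¹)^* σ)`. -/
def chartExtDeriv {k : ℕ} (x₀ : M) (σ : RawForm E M k) : RawForm E M (k + 1) := fun p ↦
  ContinuousAlternatingMap.compContinuousLinearMap (M := E) (M' := E)
    (extDeriv (localRep x₀ σ) (extChartAt 𝓘(ℝ, E) x₀ p))
    (mfderiv 𝓘(ℝ, E) 𝓘(ℝ, E) (extChartAt 𝓘(ℝ, E) x₀) p)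

/-- The de Rham differential, computed at each point in the preferred chart there. -/
def rawExtDeriv {k : ℕ} (σ : RawForm E M k) : RawForm E M (k + 1) := fun p ↦
  chartExtDeriv p σ p

lemma form_congr {k : ℕ} (σ : RawForm F N k) {p q : N} (h : p = q)
    (u : Fin k → F) : σ p u = σ q u := by
  subst h
  rfl

lemma rawPullback_id {k : ℕ} (σ : RawForm E M k) : rawPullback (id : M → M) σ = σ := by
  funext p
  ext v
  simp [rawPullback, mfderiv_id]

lemma differentiableAt_localRep {k : ℕ} {σ : RawForm E M k} (hσ : IsSmoothForm σ) (p : M) :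
    DifferentiableAt ℝ (localRep p σ) (extChartAt 𝓘(ℝ, E) p p) :=
  ((hσ p).contDiffAt ((isOpen_extChartAt_target p).mem_nhds
    (mem_extChartAt_target p))).differentiableAt (by simp)

variable [IsManifold 𝓘(ℝ, E) ∞ M] [IsManifold 𝓘(ℝ, F) ∞ N]

lemma mdiff_chart {x₀ p : M} (hp : p ∈ (extChartAt 𝓘(ℝ, E) x₀).source) :
    ContMDiffAt 𝓘(ℝ, E) 𝓘(ℝ, E) ∞ (extChartAt 𝓘(ℝ, E) x₀) p :=
  contMDiffAt_extChartAt' (by simpa using hp)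

lemma mdiff_chart_symm {x₀ : M} {y : E} (hy : y ∈ (extChartAt 𝓘(ℝ, E) x₀).target) :
    ContMDiffAt 𝓘(ℝ, E) 𝓘(ℝ, E) ∞ (extChartAt 𝓘(ℝ, E) x₀).symm y :=
  (contMDiffOn_extChartAt_symm x₀).contMDiffAt ((isOpen_extChartAt_target x₀).mem_nhds hy)

lemma localRep_pullback {f : M → N} (hf : ContMDiff 𝓘(ℝ, E) 𝓘(ℝ, F) ∞ f) {k : ℕ}
    (σ : RawForm F N k) {x₀ : M} {z₀ : N} {y : E} (hy : y ∈ (extChartAt 𝓘(ℝ, E) x₀).target)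
    (hz : f ((extChartAt 𝓘(ℝ, E) x₀).symm y) ∈ (extChartAt 𝓘(ℝ, F) z₀).source) :
    localRep x₀ (rawPullback f σ) y =
      (localRep z₀ σ ((extChartAt 𝓘(ℝ, F) z₀ ∘ f ∘ (extChartAt 𝓘(ℝ, E) x₀).symm)
        y)).compContinuousLinearMap
        (fderiv ℝ (extChartAt 𝓘(ℝ, F) z₀ ∘ f ∘ (extChartAt 𝓘(ℝ, E) x₀).symm) y) := by
  set φ := extChartAt 𝓘(ℝ, E) x₀
  set ψ := extChartAt 𝓘(ℝ, F) z₀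
  have h1 : ContMDiffAt 𝓘(ℝ, E) 𝓘(ℝ, F) ∞ (f ∘ φ.symm) y :=
    (hf _).comp _ (mdiff_chart_symm hy)
  have h2 : ContMDiffAt 𝓘(ℝ, E) 𝓘(ℝ, F) ∞ (ψ ∘ f ∘ φ.symm) y :=
    ContMDiffAt.comp (I' := 𝓘(ℝ, F)) (g := ψ) (f := f ∘ φ.symm) y (mdiff_chart hz) h1
  have h3 : ContMDiffAt 𝓘(ℝ, F) 𝓘(ℝ, F) ∞ ψ.symm ((ψ ∘ f ∘ φ.symm) y) :=
    mdiff_chart_symm (ψ.map_source hz)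
  have h4 : ψ.symm ∘ (ψ ∘ f ∘ φ.symm) =ᶠ[𝓝 y] f ∘ φ.symm := by
    have : ∀ᶠ y' in 𝓝 y, (f ∘ φ.symm) y' ∈ ψ.source :=
      h1.continuousAt ((isOpen_extChartAt_source z₀).mem_nhds hz)
    filter_upwards [this] with y' hy'
    exact ψ.left_inv hy'
  have key : (mfderiv 𝓘(ℝ, F) 𝓘(ℝ, F) ψ.symm ((ψ ∘ f ∘ φ.symm) y)).comp
      (mfderiv 𝓘(ℝ, E) 𝓘(ℝ, F) (ψ ∘ f ∘ φ.symm) y) =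
      (mfderiv 𝓘(ℝ, E) 𝓘(ℝ, F) f (φ.symm y)).comp (mfderiv 𝓘(ℝ, E) 𝓘(ℝ, E) φ.symm y) := by
    rw [← mfderiv_comp y (h3.mdifferentiableAt (by simp)) (h2.mdifferentiableAt (by simp)),
      ← mfderiv_comp y ((hf _).mdifferentiableAt (by simp))
        ((mdiff_chart_symm hy).mdifferentiableAt (by simp))]
    exact h4.mfderiv_eq
  have hq : ψ.symm ((ψ ∘ f ∘ φ.symm) y) = f (φ.symm y) := ψ.left_inv hz
  ext v
  have key' := fun i ↦ DFunLike.congr_fun key (v i)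
  rw [mfderiv_eq_fderiv] at key'
  have hu : (fun i ↦ mfderiv 𝓘(ℝ, E) 𝓘(ℝ, F) f (φ.symm y) (mfderiv 𝓘(ℝ, E) 𝓘(ℝ, E) φ.symm y (v i)))
    = fun i ↦ mfderiv 𝓘(ℝ, F) 𝓘(ℝ, F) ψ.symm ((ψ ∘ f ∘ φ.symm) y)
      (fderiv ℝ (ψ ∘ f ∘ φ.symm) y (v i)) := funext fun i ↦ (key' i).symm
  exact (form_congr σ hq.symm _).trans (congrArg (σ (ψ.symm ((ψ ∘ f ∘ φ.symm) y))) hu)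

lemma chartExtDeriv_pullback {f : M → N} (hf : ContMDiff 𝓘(ℝ, E) 𝓘(ℝ, F) ∞ f) {k : ℕ}
    {σ : RawForm F N k} (hσ : IsSmoothForm σ) {x₀ : M} {z₀ : N} {p : M}
    (hp : p ∈ (extChartAt 𝓘(ℝ, E) x₀).source) (hz : f p ∈ (extChartAt 𝓘(ℝ, F) z₀).source) :
    chartExtDeriv x₀ (rawPullback f σ) p =
      (chartExtDeriv z₀ σ (f p)).compContinuousLinearMap (mfderiv 𝓘(ℝ, E) 𝓘(ℝ, F) f p) := by
  set φ := extChartAt 𝓘(ℝ, E) x₀ with hφ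
  set ψ := extChartAt 𝓘(ℝ, F) z₀ with hψ
  set Φ := ψ ∘ f ∘ φ.symm with hΦ
  have hy : φ p ∈ φ.target := φ.map_source hp
  have hpp : φ.symm (φ p) = p := φ.left_inv hp
  have hz' : f (φ.symm (φ p)) ∈ ψ.source := by rwa [hpp]
  have hcont : ContinuousAt (f ∘ φ.symm) (φ p) :=
    ContinuousAt.comp (g := f) hf.continuous.continuousAt (mdiff_chart_symm hy).continuousAt
  have hev : localRep x₀ (rawPullback f σ) =ᶠ[𝓝 (φ p)] fun y ↦
      (localRep z₀ σ (Φ y)).compContinuousLinearMap (fderiv ℝ Φ y) := by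
    filter_upwards [(isOpen_extChartAt_target x₀).mem_nhds hy,
      hcont ((isOpen_extChartAt_source z₀).mem_nhds hz')] with y h1 h2
    exact localRep_pullback hf σ h1 h2
  have hΦp : Φ (φ p) = ψ (f p) := by simp [hΦ, hpp]
  have hzt : ψ (f p) ∈ ψ.target := ψ.map_source hz
  have hΦs : ContDiffAt ℝ ∞ Φ (φ p) := by
    rw [← contMDiffAt_iff_contDiffAt]
    exact ContMDiffAt.comp (I' := 𝓘(ℝ, F)) (g := ψ) (f := f ∘ φ.symm) _ (mdiff_chart hz')
      (ContMDiffAt.comp (g := f) (f := φ.symm) _ (hf _) (mdiff_chart_symm hy))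
  have hσd : DifferentiableAt ℝ (localRep z₀ σ) (Φ (φ p)) := by
    rw [hΦp]
    exact ((hσ z₀).contDiffAt ((isOpen_extChartAt_target z₀).mem_nhds hzt)).differentiableAt
      (by simp)
  have h4 : Φ ∘ φ =ᶠ[𝓝 p] ψ ∘ f := by
    filter_upwards [(isOpen_extChartAt_source x₀).mem_nhds hp] with q hq
    simp [hΦ, φ.left_inv hq]
  have key : (mfderiv 𝓘(ℝ, E) 𝓘(ℝ, F) Φ (φ p)).comp (mfderiv 𝓘(ℝ, E) 𝓘(ℝ, E) φ p) =
      (mfderiv 𝓘(ℝ, F) 𝓘(ℝ, F) ψ (f p)).comp (mfderiv 𝓘(ℝ, E) 𝓘(ℝ, F) f p) := by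
    rw [← mfderiv_comp p (hΦs.contMDiffAt.mdifferentiableAt (by simp))
        ((mdiff_chart hp).mdifferentiableAt (by simp)),
      ← mfderiv_comp p ((mdiff_chart hz).mdifferentiableAt (by simp))
        ((hf _).mdifferentiableAt (by simp))]
    exact h4.mfderiv_eq
  have hd : extDeriv (localRep x₀ (rawPullback f σ)) (φ p) =
      (extDeriv (localRep z₀ σ) (Φ (φ p))).compContinuousLinearMap (fderiv ℝ Φ (φ p)) := by
    rw [hev.extDeriv_eq]
    exact extDeriv_pullback hσd hΦs (by simpa using (ENat.LEInfty.out : (2 : ℕ∞ω) ≤ ∞))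
  ext v
  have key' := fun i ↦ DFunLike.congr_fun key (v i)
  rw [mfderiv_eq_fderiv] at key'
  have hu : (fun i ↦ fderiv ℝ Φ (φ p) (mfderiv 𝓘(ℝ, E) 𝓘(ℝ, E) φ p (v i))) =
    fun i ↦ mfderiv 𝓘(ℝ, F) 𝓘(ℝ, F) ψ (f p) (mfderiv 𝓘(ℝ, E) 𝓘(ℝ, F) f p (v i)) :=
    funext key'
  change extDeriv (localRep x₀ (rawPullback f σ)) (φ p)
      (fun i ↦ mfderiv 𝓘(ℝ, E) 𝓘(ℝ, E) φ p (v i)) =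
    extDeriv (localRep z₀ σ) (ψ (f p))
      (fun i ↦ mfderiv 𝓘(ℝ, F) 𝓘(ℝ, F) ψ (f p) (mfderiv 𝓘(ℝ, E) 𝓘(ℝ, F) f p (v i)))
  rw [hd, hΦp]
  exact congrArg (extDeriv (localRep z₀ σ) (ψ (f p))) hu

lemma rawExtDeriv_eq {k : ℕ} {σ : RawForm E M k} (hσ : IsSmoothForm σ) {x₀ p : M}
    (hp : p ∈ (extChartAt 𝓘(ℝ, E) x₀).source) : rawExtDeriv σ p = chartExtDeriv x₀ σ p := by
  have h := chartExtDeriv_pullback (E := E) (F := E) (f := (id : M → M))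
    (contMDiff_id (I := 𝓘(ℝ, E))) hσ (x₀ := p) (z₀ := x₀) (p := p)
    (mem_extChartAt_source p) hp
  rw [rawPullback_id] at h
  rw [rawExtDeriv, h, mfderiv_id]
  rfl

lemma rawExtDeriv_pullback {f : M → N} (hf : ContMDiff 𝓘(ℝ, E) 𝓘(ℝ, F) ∞ f) {k : ℕ}
    {σ : RawForm F N k} (hσ : IsSmoothForm σ) :
    rawExtDeriv (rawPullback f σ : RawForm E M k) = rawPullback f (rawExtDeriv σ) := by
  funext p
  exact chartExtDeriv_pullback hf hσ (mem_extChartAt_source p) (mem_extChartAt_source (f p))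

lemma localRep_rawExtDeriv {k : ℕ} {σ : RawForm E M k} (hσ : IsSmoothForm σ) {x₀ : M} {y : E}
    (hy : y ∈ (extChartAt 𝓘(ℝ, E) x₀).target) :
    localRep x₀ (rawExtDeriv σ) y = extDeriv (localRep x₀ σ) y := by
  set φ := extChartAt 𝓘(ℝ, E) x₀ with hφ
  have hs : φ.symm y ∈ φ.source := φ.map_target hy
  have hyy : φ (φ.symm y) = y := φ.right_inv hy
  have h4 : φ ∘ φ.symm =ᶠ[𝓝 y] id := by
    filter_upwards [(isOpen_extChartAt_target x₀).mem_nhds hy] with q hq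
    exact φ.right_inv hq
  have key : (mfderiv 𝓘(ℝ, E) 𝓘(ℝ, E) φ (φ.symm y)).comp (mfderiv 𝓘(ℝ, E) 𝓘(ℝ, E) φ.symm y) =
      ContinuousLinearMap.id ℝ E := by
    rw [← mfderiv_comp y ((mdiff_chart hs).mdifferentiableAt (by simp))
        ((mdiff_chart_symm hy).mdifferentiableAt (by simp)), h4.mfderiv_eq, mfderiv_id]
    rfl
  ext v
  have hu : (fun i ↦ mfderiv 𝓘(ℝ, E) 𝓘(ℝ, E) φ (φ.symm y)
    (mfderiv 𝓘(ℝ, E) 𝓘(ℝ, E) φ.symm y (v i))) = v :=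
    funext fun i ↦ DFunLike.congr_fun key (v i)
  change rawExtDeriv σ (φ.symm y) (fun i ↦ mfderiv 𝓘(ℝ, E) 𝓘(ℝ, E) φ.symm y (v i)) = _
  rw [rawExtDeriv_eq hσ hs]
  change extDeriv (localRep x₀ σ) (φ (φ.symm y)) (fun i ↦ mfderiv 𝓘(ℝ, E) 𝓘(ℝ, E) φ (φ.symm y)
    (mfderiv 𝓘(ℝ, E) 𝓘(ℝ, E) φ.symm y (v i))) = _
  rw [hyy]
  exact congrArg (extDeriv (localRep x₀ σ) y) hu

lemma isSmoothForm_rawExtDeriv {k : ℕ} {σ : RawForm E M k} (hσ : IsSmoothForm σ) :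
    IsSmoothForm (rawExtDeriv σ) := by
  intro x₀
  have h1 : ContDiffOn ℝ ∞ (extDeriv (localRep x₀ σ)) (extChartAt 𝓘(ℝ, E) x₀).target := by
    have h2 := (hσ x₀).fderiv_of_isOpen (m := ∞) (isOpen_extChartAt_target x₀) (by simp)
    exact (ContinuousAlternatingMap.alternatizeUncurryFinCLM ℝ E ℝ (n := k)).contDiff.comp_contDiffOn
      h2
  exact h1.congr fun y hy ↦ localRep_rawExtDeriv hσ hy

variable (E M) in
/-- The de Rham differential `d : Ω^k(M) → Ω^{k+1}(M)`. -/
def dR (k : ℕ) : Form E M k →ₗ[ℝ] Form E M (k + 1) where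
  toFun σ := ⟨rawExtDeriv σ.1, isSmoothForm_rawExtDeriv σ.2⟩
  map_add' σ η := by
    refine Subtype.ext (funext fun p ↦ ?_)
    ext v
    change extDeriv (localRep p σ.1 + localRep p η.1) _ _ = _
    rw [extDeriv_add (differentiableAt_localRep σ.2 p) (differentiableAt_localRep η.2 p)]
    rfl
  map_smul' c σ := by
    refine Subtype.ext (funext fun p ↦ ?_)
    ext v
    change extDeriv (c • localRep p σ.1) _ _ = _
    rw [extDeriv_smul]
    rfl

end Forms

section Contraction

variable {E : Type*} [NormedAddCommGroup E] [NormedSpace ℝ E]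

/-- The contraction `ι(v₁ ∧ ⋯ ∧ vₖ) a = ι(vₖ) ⋯ ι(v₁) a = a(v₁, …, vₖ, ·, …, ·)` of an
alternating form on a vector space. -/
def contract {j : ℕ} : ∀ k : ℕ, (Fin k → E) → E [⋀^Fin (j + k)]→L[ℝ] ℝ → E [⋀^Fin j]→L[ℝ] ℝ
  | 0, _, a => a
  | k + 1, v, a => contract k (Fin.tail v) (a.curryLeft (v 0))

/-- The concatenated list `(v₁, …, vₖ, w₁, …, wⱼ)`. -/
lemma contract_apply {j : ℕ} (k : ℕ) (v : Fin k → E) (a : E [⋀^Fin (j + k)]→L[ℝ] ℝ)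
    (w : Fin j → E) :
    contract k v a w = a (fun i ↦ Fin.append v w (i.cast (Nat.add_comm j k))) := by
  induction k with
  | zero =>
    have : (fun i : Fin (j + 0) ↦ Fin.append v w (i.cast (Nat.add_comm j 0))) = w := by
      funext i
      have : i.cast (Nat.add_comm j 0) = Fin.natAdd 0 i := by ext; simp
      rw [this, Fin.append_right]
    rw [this]
    rfl
  | succ k ih =>
    rw [contract, ih, ContinuousAlternatingMap.curryLeft_apply_apply]
    congr 1
    funext i
    induction i using Fin.cases with
    | zero =>
      have : (0 : Fin (j + (k + 1))).cast (Nat.add_comm j (k + 1)) = Fin.castAdd j 0 := by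
        ext; simp
      change v 0 = Fin.append v w ((0 : Fin (j + (k + 1))).cast _)
      rw [this, Fin.append_left]
    | succ i =>
      change Fin.append (Fin.tail v) w (i.cast _) = _
      have hi : (i.succ : Fin (j + (k + 1))).cast (Nat.add_comm j (k + 1)) =
          ((i.cast (Nat.add_comm j k)).succ).cast (by omega) := by
        ext; simp
      refine Eq.trans ?_ (congrArg (Fin.append v w) hi).symm
      generalize i.cast (Nat.add_comm j k) = i'
      induction i' using Fin.addCases with
      | left a =>
        have : ((Fin.castAdd j a).succ).cast (by omega : k + j + 1 = k + 1 + j) =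
          Fin.castAdd j a.succ := by ext; simp
        rw [this, Fin.append_left, Fin.append_left]
        rfl
      | right b =>
        have : ((Fin.natAdd k b).succ).cast (by omega : k + j + 1 = k + 1 + j) =
          Fin.natAdd (k + 1) b := by ext; simp; omega
        rw [this, Fin.append_right, Fin.append_right]

lemma contract_add {j : ℕ} (k : ℕ) (v : Fin k → E) (a b : E [⋀^Fin (j + k)]→L[ℝ] ℝ) :
    contract k v (a + b) = contract k v a + contract k v b := by
  ext w
  simp [contract_apply]

lemma contract_smul {j : ℕ} (k : ℕ) (v : Fin k → E) (c : ℝ) (a : E [⋀^Fin (j + k)]→L[ℝ] ℝ) :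
    contract k v (c • a) = c • contract k v a := by
  ext w
  simp [contract_apply]

lemma append_update {j k : ℕ} [DecidableEq (Fin k)] (v : Fin k → E) (w : Fin j → E) (i : Fin k)
    (x : E) : (fun l : Fin (j + k) ↦ Fin.append (Function.update v i x) w
        (l.cast (Nat.add_comm j k))) =
      Function.update (fun l : Fin (j + k) ↦ Fin.append v w (l.cast (Nat.add_comm j k)))
        ((Fin.castAdd j i).cast (Nat.add_comm k j)) x := by
  funext l
  obtain ⟨l', rfl⟩ : ∃ l' : Fin (k + j), l = l'.cast (Nat.add_comm k j) := ⟨l.cast (by omega), rfl⟩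
  induction l' using Fin.addCases with
  | left b =>
    by_cases hb : b = i
    · subst hb; simp
    · have : (Fin.castAdd j b).cast (Nat.add_comm k j) ≠ (Fin.castAdd j i).cast (Nat.add_comm k j) :=
        fun h ↦ hb (by simpa [Fin.ext_iff] using h)
      rw [Function.update_of_ne this]
      simp [hb]
  | right b =>
    have : (Fin.natAdd k b).cast (Nat.add_comm k j) ≠ (Fin.castAdd j i).cast (Nat.add_comm k j) :=
      fun h ↦ by simp [Fin.ext_iff] at h; omega
    rw [Function.update_of_ne this]
    simp

lemma contract_update_add {j : ℕ} (k : ℕ) [DecidableEq (Fin k)] (v : Fin k → E) (i : Fin k)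
    (x y : E) (a : E [⋀^Fin (j + k)]→L[ℝ] ℝ) :
    contract k (Function.update v i (x + y)) a =
      contract k (Function.update v i x) a + contract k (Function.update v i y) a := by
  ext w
  simp only [contract_apply, append_update, ContinuousAlternatingMap.map_update_add,
    ContinuousAlternatingMap.add_apply]

lemma contract_update_smul {j : ℕ} (k : ℕ) [DecidableEq (Fin k)] (v : Fin k → E) (i : Fin k)
    (c : ℝ) (x : E) (a : E [⋀^Fin (j + k)]→L[ℝ] ℝ) :
    contract k (Function.update v i (c • x)) a = c • contract k (Function.update v i x) a := by
  ext w
  simp only [contract_apply, append_update, ContinuousAlternatingMap.map_update_smul,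
    ContinuousAlternatingMap.smul_apply]

lemma contract_eq_zero {j : ℕ} (k : ℕ) (v : Fin k → E) (a : E [⋀^Fin (j + k)]→L[ℝ] ℝ)
    {i l : Fin k} (h : v i = v l) (hil : i ≠ l) : contract k v a = 0 := by
  ext w
  rw [contract_apply]
  refine a.map_eq_zero_of_eq _ (i := (Fin.castAdd j i).cast (Nat.add_comm k j))
    (j := (Fin.castAdd j l).cast (Nat.add_comm k j)) ?_ fun h' ↦ hil ?_
  · simpa using h
  · simpa [Fin.ext_iff] using h'

lemma contDiff_curryLeft {k : ℕ} : ContDiff ℝ ∞ (fun a : E [⋀^Fin (k + 1)]→L[ℝ] ℝ ↦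
    (a.curryLeft : E →L[ℝ] E [⋀^Fin k]→L[ℝ] ℝ)) := by
  have h : IsBoundedLinearMap ℝ (fun a : E [⋀^Fin (k + 1)]→L[ℝ] ℝ ↦
      (a.curryLeft : E →L[ℝ] E [⋀^Fin k]→L[ℝ] ℝ)) := by
    refine IsLinearMap.with_bound ⟨fun _ _ ↦ rfl, fun _ _ ↦ rfl⟩ 1 fun a ↦ ?_
    rw [one_mul]
    exact (ContinuousAlternatingMap.norm_curryLeft a).le
  exact h.contDiff

end Contraction

section VF
variable {E : Type*} [NormedAddCommGroup E] [NormedSpace ℝ E] [CompleteSpace E]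
  {M : Type*} [TopologicalSpace M] [ChartedSpace E M] [IsManifold 𝓘(ℝ, E) ∞ M]

/-- Smoothness of a vector field. -/
def IsSmoothField (X : ∀ p : M, TangentSpace 𝓘(ℝ, E) p) : Prop :=
  ContMDiff 𝓘(ℝ, E) 𝓘(ℝ, E).tangent ∞ (fun p ↦ (⟨p, X p⟩ : TangentBundle 𝓘(ℝ, E) M))

lemma isInv {x₀ : M} {y : E} (hy : y ∈ (extChartAt 𝓘(ℝ, E) x₀).target) :
    (mfderiv 𝓘(ℝ, E) 𝓘(ℝ, E) (extChartAt 𝓘(ℝ, E) x₀).symm y).IsInvertible := by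
  have := isInvertible_mfderivWithin_extChartAt_symm (I := 𝓘(ℝ, E)) hy
  simpa using this

/-- The interior product with a vector field. -/
def rawInterior {k : ℕ} (X : ∀ p : M, TangentSpace 𝓘(ℝ, E) p) (σ : RawForm E M (k + 1)) :
    RawForm E M k := fun p ↦ ContinuousAlternatingMap.curryLeft (E := E) (σ p) (X p)

lemma IsSmoothForm.interior {k : ℕ} {X : ∀ p : M, TangentSpace 𝓘(ℝ, E) p} (hX : IsSmoothField X)
    {σ : RawForm E M (k + 1)} (hσ : IsSmoothForm σ) : IsSmoothForm (rawInterior X σ) := by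
  intro x₀
  set φ := extChartAt 𝓘(ℝ, E) x₀ with hφ
  let W : E → E := VectorField.mpullback 𝓘(ℝ, E) 𝓘(ℝ, E) φ.symm X
  have hW : ContDiffOn ℝ ∞ W φ.target := by
    intro y hy
    apply ContDiffAt.contDiffWithinAt
    rw [← contMDiffAt_vectorSpace_iff_contDiffAt]
    exact ContMDiffAt.mpullback_vectorField_preimage (n := ∞) (hX _) (mdiff_chart_symm hy) (isInv hy) (by simp)
  have h1 : ContDiffOn ℝ ∞ (fun y ↦ (localRep x₀ σ y).curryLeft (W y)) φ.target := by
    have h2 : ContDiffOn ℝ ∞ (fun y ↦ (localRep x₀ σ y).curryLeft) φ.target :=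
      contDiff_curryLeft.comp_contDiffOn (hσ x₀)
    exact h2.clm_apply hW
  refine h1.congr fun y hy ↦ ?_
  have h3 : mfderiv 𝓘(ℝ, E) 𝓘(ℝ, E) φ.symm y (W y) = X (φ.symm y) :=
    (isInv hy).self_apply_inverse _
  ext v
  change σ (φ.symm y) (Matrix.vecCons (X (φ.symm y)) (fun i ↦ mfderiv 𝓘(ℝ, E) 𝓘(ℝ, E) φ.symm y (v i))) =
    σ (φ.symm y) (fun i ↦ mfderiv 𝓘(ℝ, E) 𝓘(ℝ, E) φ.symm y (Matrix.vecCons (W y) v i))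
  congr 1
  funext i
  induction i using Fin.cases with
  | zero => exact h3.symm
  | succ i => rfl

variable {H : Type*} [NormedAddCommGroup H] [NormedSpace ℝ H]
  {G : Type*} [TopologicalSpace G] [ChartedSpace H G] [Group G] [LieGroup 𝓘(ℝ, H) ∞ G]
  [MulAction G M] [ContMDiffSMul 𝓘(ℝ, H) 𝓘(ℝ, E) ∞ G M]

/-- The infinitesimal generator `v_x` of the action, `v_x(p) = d/dt|₀ exp(-tx) • p`: the
derivative at the identity of `g ↦ g⁻¹ • p`, in the direction `x`. With this sign
`x ↦ v_x` is a homomorphism of Lie algebras. -/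
def generator (x : GroupLieAlgebra 𝓘(ℝ, H) G) : ∀ p : M, TangentSpace 𝓘(ℝ, E) p := fun p ↦
  -- this is a tangent vector at `1⁻¹ • p = p`; all tangent spaces are copies of `E`
  (mfderiv 𝓘(ℝ, H) 𝓘(ℝ, E) (fun g : G ↦ g⁻¹ • p) 1 x : E)

lemma totalSpace_congr {p q : M} (h : p = q) (a : E) :
    (⟨p, a⟩ : TangentBundle 𝓘(ℝ, E) M) = ⟨q, a⟩ := by
  subst h
  rfl

lemma isSmoothField_generator (x : GroupLieAlgebra 𝓘(ℝ, H) G) :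
    IsSmoothField (generator (M := M) (E := E) x) := by
  let act : G × M → M := fun q ↦ q.1⁻¹ • q.2
  have hact : ContMDiff (𝓘(ℝ, H).prod 𝓘(ℝ, E)) 𝓘(ℝ, E) ∞ act :=
    ContMDiff.smul (I := 𝓘(ℝ, H)) (contMDiff_fst.inv) contMDiff_snd
  let fg : M → TangentBundle 𝓘(ℝ, E) M := fun p ↦ Bundle.TotalSpace.mk' E p 0
  have sfg : ContMDiff 𝓘(ℝ, E) 𝓘(ℝ, E).tangent ∞ fg := Bundle.contMDiff_zeroSection _ _
  let fv : M → TangentBundle 𝓘(ℝ, H) G := fun _ ↦ Bundle.TotalSpace.mk' H 1 x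
  have sfv : ContMDiff 𝓘(ℝ, E) 𝓘(ℝ, H).tangent ∞ fv := contMDiff_const
  let F₁ : M → (TangentBundle 𝓘(ℝ, H) G × TangentBundle 𝓘(ℝ, E) M) := fun g ↦ (fv g, fg g)
  have S₁ : ContMDiff 𝓘(ℝ, E) (𝓘(ℝ, H).tangent.prod 𝓘(ℝ, E).tangent) ∞ F₁ := sfv.prodMk sfg
  have S₂ := (contMDiff_equivTangentBundleProd_symm (I := 𝓘(ℝ, H)) (M := G)
    (I' := 𝓘(ℝ, E)) (M' := M) (n := ∞)).comp S₁
  have S₃ := (ContMDiff.contMDiff_tangentMap hact (m := ∞) (by simp)).comp S₂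
  refine ContMDiff.congr S₃ fun p ↦ ?_
  have hp : p = act (1, p) := by simp [act]
  refine (totalSpace_congr hp _).trans ?_
  have h := mfderiv_prod_eq_add_apply (I := 𝓘(ℝ, H)) (I' := 𝓘(ℝ, E)) (I'' := 𝓘(ℝ, E)) (f := act)
    (p := ((1 : G), p)) (v := (x, (0 : E))) (hact.mdifferentiableAt (by simp))
  have h' : mfderiv (𝓘(ℝ, H).prod 𝓘(ℝ, E)) 𝓘(ℝ, E) act ((1 : G), p) (x, (0 : E)) =
      mfderiv 𝓘(ℝ, H) 𝓘(ℝ, E) (fun g : G ↦ g⁻¹ • p) 1 x := by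
    refine h.trans ?_
    have : mfderiv 𝓘(ℝ, E) 𝓘(ℝ, E) (fun q : M ↦ act ((1 : G), q)) p (0 : E) = (0 : E) :=
      ContinuousLinearMap.map_zero _
    exact (congrArg _ this).trans (add_zero _)
  exact congrArg (fun a : E ↦ (⟨act (1, p), a⟩ : TangentBundle 𝓘(ℝ, E) M)) h'.symm
end VF

section CE

variable {L V : Type*} [LieRing L] [LieAlgebra ℝ L] [AddCommGroup V] [Module ℝ V]

/-- The sum `∑_{a < b} (-1)^{a + b} φ([x_a, x_b], x₀, …, x̂_a, …, x̂_b, …)`. Pairs `a < b` are written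
as `a = i`, `b = j + 1` with `i ≤ j`. -/
def bracketSum {k : ℕ} (φ : L [⋀^Fin (k + 1)]→ₗ[ℝ] V) (x : Fin (k + 2) → L) : V :=
  ∑ i : Fin (k + 1), ∑ j ≥ i, (-1 : ℝ) ^ ((i : ℕ) + ((j : ℕ) + 1)) •
    φ (Matrix.vecCons ⁅x i.castSucc, x j.succ⁆ (j.removeNth (i.castSucc.removeNth x)))

/-- Sum over all ordered pairs, used to see that `bracketSum` is alternating. -/
def doubleSum {k : ℕ} (φ : L [⋀^Fin (k + 1)]→ₗ[ℝ] V) : L [⋀^Fin (k + 2)]→ₗ[ℝ] V :=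
  AlternatingMap.alternatizeUncurryFin
    (AlternatingMap.alternatizeUncurryFinLM ∘ₗ
      ({ toFun := fun x ↦ φ.curryLeft ∘ₗ (LieAlgebra.ad ℝ L x : L →ₗ[ℝ] L)
         map_add' := fun x y ↦ by ext; simp
         map_smul' := fun c x ↦ by ext; simp } : L →ₗ[ℝ] L →ₗ[ℝ] L [⋀^Fin k]→ₗ[ℝ] V))

lemma bracketSum_eq {k : ℕ} (φ : L [⋀^Fin (k + 1)]→ₗ[ℝ] V) (x : Fin (k + 2) → L) :
    bracketSum φ x = (-(1 / 2 : ℝ)) • doubleSum φ x := by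
  have h : doubleSum φ x = (-2 : ℝ) • bracketSum φ x := by
    rw [doubleSum, AlternatingMap.alternatizeUncurryFin_alternatizeUncurryFinLM_comp_apply,
      bracketSum, Finset.smul_sum]
    refine Finset.sum_congr rfl fun i _ ↦ ?_
    rw [Finset.smul_sum]
    refine Finset.sum_congr rfl fun j _ ↦ ?_
    have hsw : ⁅x j.succ, x i.castSucc⁆ = -⁅x i.castSucc, x j.succ⁆ := (lie_skew _ _).symm
    have hc (u : L) (w : Fin k → L) : φ (Matrix.vecCons u w) = φ.curryLeft u w := rfl
    change (-1 : ℤ) ^ (i + j : ℕ) • (φ.curryLeft ⁅x i.castSucc, x j.succ⁆ _ -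
      φ.curryLeft ⁅x j.succ, x i.castSucc⁆ _) = _
    have hz (u : V) : (-1 : ℤ) ^ (i + j : ℕ) • u = (-1 : ℝ) ^ (i + j : ℕ) • u := by
      rcases Nat.even_or_odd (i + j : ℕ) with h | h <;> simp [h.neg_one_pow]
    rw [hsw, map_neg, AlternatingMap.neg_apply, sub_neg_eq_add, ← two_smul ℝ, hc, hz, smul_smul,
      smul_smul, ← add_assoc, pow_succ]
    congr 1
    ring
  rw [h, smul_smul]
  norm_num

/-- The Chevalley-Eilenberg differential on `Λ^{k+1} L^* ⊗ V`, where `V` is a trivial module. -/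
def dCE (k : ℕ) : (L [⋀^Fin (k + 1)]→ₗ[ℝ] V) →ₗ[ℝ] (L [⋀^Fin (k + 2)]→ₗ[ℝ] V) where
  toFun φ :=
    { toFun := bracketSum φ
      map_update_add' := fun {inst} x i a b ↦ by
        simp only [bracketSum_eq, AlternatingMap.map_update_add, smul_add]
      map_update_smul' := fun {inst} x i c a ↦ by
        simp only [bracketSum_eq, AlternatingMap.map_update_smul]
        exact smul_comm _ _ _
      map_eq_zero_of_eq' := fun x i j h hij ↦ by
        rw [bracketSum_eq, AlternatingMap.map_eq_zero_of_eq _ x h hij, smul_zero] }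
  map_add' φ ψ := by
    ext x
    simp [bracketSum, Finset.sum_add_distrib]
  map_smul' c φ := by
    ext x
    simp [bracketSum, Finset.smul_sum, smul_comm c]

end CE

section Cone

instance instCompleteSpaceOfFiniteDimensionalReal (E : Type*) [NormedAddCommGroup E]
    [NormedSpace ℝ E] [FiniteDimensional ℝ E] : CompleteSpace E :=
  FiniteDimensional.complete ℝ E

instance instLieGroupMinSmoothness {H : Type*} [NormedAddCommGroup H] [NormedSpace ℝ H]
    {G : Type*} [TopologicalSpace G] [ChartedSpace H G] [Group G] [LieGroup 𝓘(ℝ, H) ∞ G] :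
    LieGroup 𝓘(ℝ, H) (minSmoothness ℝ 3) G := by
  rw [minSmoothness_of_isRCLikeNormedField]
  infer_instance

variable {E : Type*} [NormedAddCommGroup E] [NormedSpace ℝ E] [FiniteDimensional ℝ E]
  {M : Type*} [TopologicalSpace M] [ChartedSpace E M] [IsManifold 𝓘(ℝ, E) ∞ M]
  {H : Type*} [NormedAddCommGroup H] [NormedSpace ℝ H] [FiniteDimensional ℝ H]
  {G : Type*} [TopologicalSpace G] [ChartedSpace H G] [Group G] [LieGroup 𝓘(ℝ, H) ∞ G]
  [MulAction G M] [ContMDiffSMul 𝓘(ℝ, H) 𝓘(ℝ, E) ∞ G M]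

/-- `ι(X₁ ∧ ⋯ ∧ Xₖ) σ` for vector fields `X₁, …, Xₖ`. -/
def rawContract {k j : ℕ} (X : Fin k → ∀ p : M, TangentSpace 𝓘(ℝ, E) p)
    (σ : RawForm E M (j + k)) : RawForm E M j := fun p ↦
  contract (E := E) k (fun i ↦ X i p) (σ p)

lemma isSmoothForm_rawContract {k j : ℕ} {X : Fin k → ∀ p : M, TangentSpace 𝓘(ℝ, E) p}
    (hX : ∀ i, IsSmoothField (X i)) {σ : RawForm E M (j + k)} (hσ : IsSmoothForm σ) :
    IsSmoothForm (rawContract X σ) := by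
  induction k with
  | zero => exact hσ
  | succ k ih => exact ih (fun i ↦ hX i.succ) (IsSmoothForm.interior (hX 0) hσ)

lemma generator_update {k : ℕ} (x : Fin k → GroupLieAlgebra 𝓘(ℝ, H) G) [DecidableEq (Fin k)]
    (i : Fin k) (a : GroupLieAlgebra 𝓘(ℝ, H) G) (p : M) :
    (fun l ↦ (generator (E := E) (Function.update x i a l) p : E)) =
      Function.update (fun l ↦ (generator (E := E) (x l) p : E)) i (generator (E := E) a p) := by
  funext l
  by_cases hl : l = i
  · subst hl; simp
  · simp [hl]

variable (H G) in
/-- For `σ ∈ Ω^{j+k}(M)`, the map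
`σ_k : Λ^k 𝔤 → Ω^j(M)`, `(x₁, …, xₖ) ↦ ι(v_{x₁} ∧ ⋯ ∧ v_{xₖ}) σ`. -/
def contractGen (k j : ℕ) : Form E M (j + k) →ₗ[ℝ]
    (GroupLieAlgebra 𝓘(ℝ, H) G [⋀^Fin k]→ₗ[ℝ] Form E M j) where
  toFun σ :=
    { toFun := fun x ↦ ⟨rawContract (fun i ↦ generator (x i)) σ.1,
        isSmoothForm_rawContract (fun i ↦ isSmoothField_generator (x i)) σ.2⟩
      map_update_add' := fun {_} x i a b ↦ by
        refine Subtype.ext (funext fun p ↦ ?_)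
        have hab : (generator (E := E) (a + b) p : E) =
          (generator (E := E) a p : E) + generator (E := E) b p := map_add _ a b
        change contract (E := E) k _ (σ.1 p) =
          contract (E := E) k _ (σ.1 p) + contract (E := E) k _ (σ.1 p)
        rw [generator_update, generator_update, generator_update, hab]
        exact contract_update_add (E := E) k _ i _ _ (σ.1 p)
      map_update_smul' := fun {_} x i c a ↦ by
        refine Subtype.ext (funext fun p ↦ ?_)
        have hab : (generator (E := E) (c • a) p : E) =
          c • (generator (E := E) a p : E) := map_smul _ c a
        change contract (E := E) k _ (σ.1 p) = c • contract (E := E) k _ (σ.1 p)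
        rw [generator_update, generator_update, hab]
        exact contract_update_smul (E := E) k _ i _ _ (σ.1 p)
      map_eq_zero_of_eq' := fun x i j h hij ↦ by
        refine Subtype.ext (funext fun p ↦ ?_)
        refine contract_eq_zero (E := E) k (fun i ↦ generator (x i) p) (σ.1 p) (i := i) (l := j)
          ?_ hij
        rw [h] }
  map_add' σ η := by
    ext1 x
    exact Subtype.ext (funext fun p ↦ contract_add (E := E) k _ (σ.1 p) (η.1 p))
  map_smul' c σ := by
    ext1 x
    exact Subtype.ext (funext fun p ↦ contract_smul (E := E) k _ c (σ.1 p))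

variable (E M G) in
/-- The subspace of `G`-invariant `k`-forms. -/
def invariantForms (k : ℕ) : Submodule ℝ (Form E M k) where
  carrier := {σ | ∀ g : G, rawPullback (fun p : M ↦ g • p) σ.1 = σ.1}
  add_mem' := fun {σ η} hσ hη g ↦ by
    refine Eq.trans ?_ (congrArg₂ (· + ·) (hσ g) (hη g))
    rfl
  zero_mem' := fun _ ↦ rfl
  smul_mem' := fun c σ hσ g ↦ by
    refine Eq.trans ?_ (congrArg (c • ·) (hσ g))
    rfl

variable (E M G) in
/-- `Ω^k(M)^G`. -/
def InvForm (k : ℕ) : Type _ := ↥(invariantForms E M G k)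

instance instAddCommGroupInvForm (k : ℕ) : AddCommGroup (InvForm E M G k) :=
  inferInstanceAs (AddCommGroup ↥(invariantForms E M G k))

instance instModuleInvForm (k : ℕ) : Module ℝ (InvForm E M G k) :=
  inferInstanceAs (Module ℝ ↥(invariantForms E M G k))

/-- The inclusion `Ω^k(M)^G → Ω^k(M)`. -/
def InvForm.toForm {k : ℕ} : InvForm E M G k →ₗ[ℝ] Form E M k := (invariantForms E M G k).subtype

variable (E M H G) in
/-- The de Rham differential on invariant forms. -/
def dInv (k : ℕ) : InvForm E M G k →ₗ[ℝ] InvForm E M G (k + 1) :=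
  (dR E M k).restrict (p := invariantForms E M G k) (q := invariantForms E M G (k + 1))
    fun σ hσ g ↦ by
    have hg : ContMDiff 𝓘(ℝ, E) 𝓘(ℝ, E) ∞ (fun p : M ↦ g • p) :=
      ContMDiffSMul.contMDiff_const_smul (I := 𝓘(ℝ, H)) g
    change rawPullback _ (rawExtDeriv σ.1) = rawExtDeriv σ.1
    rw [← rawExtDeriv_pullback hg σ.2, hσ g]

variable (E M G) in
/-- The homogeneous component of degree `n ∈ ℤ` of the graded vector space `Ω(M)^G`: a family with
one member if `n ≥ 0`, and the zero space if `n < 0`. -/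
abbrev InvDeg (n : ℤ) : Type _ := ∀ i : {i : ℕ // (i : ℤ) = n}, InvForm E M G i.1

variable (E M H G) in
/-- The homogeneous component of degree `n ∈ ℤ` of `Λ^{≥1} 𝔤^* ⊗ Ω(M)`: families of alternating
maps `φ_{k+1} : Λ^{k+1} 𝔤 → Ω^j(M)`, one for each pair `(k, j)` with `j + (k + 1) = n`. As `𝔤` is
finite-dimensional, `Λ^k 𝔤^* ⊗ Ω^j(M)` is the space of alternating maps `𝔤^k → Ω^j(M)`. -/
abbrev TotDeg (n : ℤ) : Type _ := ∀ q : {q : ℕ × ℕ // ((q.2 + (q.1 + 1) : ℕ) : ℤ) = n},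
  GroupLieAlgebra 𝓘(ℝ, H) G [⋀^Fin (q.1.1 + 1)]→ₗ[ℝ] Form E M q.1.2

variable (E M H G) in
/-- The differential of `Ω(M)^G` in degree `n`. -/
def dInvDeg (n : ℤ) : InvDeg E M G n →ₗ[ℝ] InvDeg E M G (n + 1) where
  toFun σ
    | ⟨0, _⟩ => 0
    | ⟨i + 1, h⟩ => dInv E M H G i (σ ⟨i, by push_cast at h; omega⟩)
  map_add' σ η := by
    funext ⟨i, h⟩
    cases i <;> simp
  map_smul' c σ := by
    funext ⟨i, h⟩
    cases i <;> simp

variable (E M H G) in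
/-- The Chevalley-Eilenberg part `d_𝔤 ⊗ 1` of the total differential. -/
def dTotCE (n : ℤ) : TotDeg E M H G n →ₗ[ℝ] TotDeg E M H G (n + 1) where
  toFun φ
    | ⟨(0, _), _⟩ => 0
    | ⟨(k + 1, j), h⟩ => dCE (L := GroupLieAlgebra 𝓘(ℝ, H) G) (V := Form E M j) k
        (φ ⟨(k, j), by push_cast at h ⊢; omega⟩)
  map_add' φ ψ := by
    funext ⟨⟨k, j⟩, h⟩
    cases k <;> simp
  map_smul' c φ := by
    funext ⟨⟨k, j⟩, h⟩
    cases k <;> simp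

variable (E M H G) in
/-- The de Rham part `1 ⊗ d` of the total differential, with the Koszul sign `(-1)^k` on
`Λ^k 𝔤^* ⊗ Ω(M)`. -/
def dTotDR (n : ℤ) : TotDeg E M H G n →ₗ[ℝ] TotDeg E M H G (n + 1) where
  toFun φ
    | ⟨(_, 0), _⟩ => 0
    | ⟨(k, j + 1), h⟩ => (-1 : ℝ) ^ (k + 1) •
        (dR E M j).compAlternatingMap (φ ⟨(k, j), by push_cast at h ⊢; omega⟩)
  map_add' φ ψ := by
    funext ⟨⟨k, j⟩, h⟩
    cases j <;> simp
  map_smul' c φ := by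
    funext ⟨⟨k, j⟩, h⟩
    cases j <;> simp [smul_comm c]

variable (E M H G) in
/-- The total differential `d_tot = d_𝔤 ⊗ 1 + 1 ⊗ d`. -/
def dTot (n : ℤ) : TotDeg E M H G n →ₗ[ℝ] TotDeg E M H G (n + 1) :=
  dTotCE E M H G n + dTotDR E M H G n

variable (E M H G) in
/-- The map `σ ↦ σ̃ = ∑_{k ≥ 1} (-1)^{k-1} σ_k` from invariant forms to `Λ^{≥1} 𝔤^* ⊗ Ω(M)`. -/
def tilde (n : ℤ) : InvDeg E M G n →ₗ[ℝ] TotDeg E M H G n where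
  toFun σ q := (-1 : ℝ) ^ q.1.1 • contractGen H G (q.1.1 + 1) q.1.2 (σ ⟨_, q.2⟩).toForm
  map_add' σ η := by
    funext q
    simp
  map_smul' c σ := by
    funext q
    simp [smul_comm c]

variable (E M H G) in
/-- The cone `B = Ω(M)^G[1] ⊕ (Λ^{≥1} 𝔤^* ⊗ Ω(M))` in degree `n`. -/
abbrev Cone (n : ℤ) : Type _ := InvDeg E M G (n + 1) × TotDeg E M H G n

variable (E M H G) in
/-- The differential `D(σ[1], φ) = (dσ[1], σ̃ - d_tot φ)` of the cone. -/
def coneD (n : ℤ) : Cone E M H G n →ₗ[ℝ] Cone E M H G (n + 1) where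
  toFun b := (dInvDeg E M H G (n + 1) b.1, tilde E M H G (n + 1) b.1 - dTot E M H G n b.2)
  map_add' b c := by
    refine Prod.ext (map_add _ _ _) ?_
    change tilde E M H G (n + 1) (b.1 + c.1) - dTot E M H G n (b.2 + c.2) = _
    rw [map_add, map_add, add_sub_add_comm]
    rfl
  map_smul' r b := by
    refine Prod.ext (map_smul _ _ _) ?_
    change tilde E M H G (n + 1) (r • b.1) - dTot E M H G n (r • b.2) = _
    rw [map_smul, map_smul, ← smul_sub]
    rfl

/-- For `m ≥ 0` the homogeneous component of `Ω(M)^G` in degree `m` is `Ω^m(M)^G`. -/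
def invDegEquiv {m : ℕ} {n : ℤ} (h : (m : ℤ) = n) : InvDeg E M G n ≃ₗ[ℝ] InvForm E M G m :=
  LinearEquiv.ofBijective
    (LinearMap.proj (R := ℝ) (φ := fun i : {i : ℕ // (i : ℤ) = n} ↦ InvForm E M G i.1) ⟨m, h⟩) <| by
    refine ⟨fun σ η hση ↦ ?_, fun w ↦ ⟨fun i ↦ (show m = i.1 by have := i.2; omega) ▸ w, rfl⟩⟩
    funext ⟨i, hi⟩
    obtain rfl : i = m := by omega
    exact hση

/-- `ς(k) = -(-1)^{k(k+1)/2}`. -/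
def varsigma (k : ℕ) : ℝ := -(-1) ^ (k * (k + 1) / 2)

variable (H G) in
/-- `contractGen` for a form `σ` of degree `N = j + k`. -/
def contractForm {k j N : ℕ} (h : j + k = N) (σ : Form E M N) :
    GroupLieAlgebra 𝓘(ℝ, H) G [⋀^Fin k]→ₗ[ℝ] Form E M j :=
  contractGen H G k j (h ▸ σ)

/-- `f` consists of the components `f_k : Λ^k 𝔤 → Ω^{n-k}(M)`, `1 ≤ k ≤ n`, of a homotopy moment
map for the action of `G` on `(M, σ)`, where `σ` is an `(n+1)`-form. The component `f_{k+1}` is `f ⟨(k, j), _⟩` where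
`j + (k + 1) = n`. -/
structure IsMomentMap {n : ℕ} (σ : Form E M (n + 1)) (f : TotDeg E M H G n) : Prop where
  /-- `d f₁(x) = -ι(v_x) σ`. -/
  one : ∀ (j : ℕ) (h : j + 1 = n) (x : Fin 1 → GroupLieAlgebra 𝓘(ℝ, H) G),
    dR E M j (f ⟨(0, j), by simp [← h]⟩ x) =
      -contractForm H G (k := 1) (j := j + 1) (by omega) σ x
  /-- For `2 ≤ k ≤ n` (here `k = l + 2`):
  `∑_{a<b} (-1)^{a+b+1} f_{k-1}([x_a, x_b], …) = d f_k(x₁, …, xₖ) + ς(k) ι(v_{x₁} ∧ ⋯ ∧ v_{xₖ}) σ`. -/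
  middle : ∀ (l j : ℕ) (h : j + (l + 2) = n) (x : Fin (l + 2) → GroupLieAlgebra 𝓘(ℝ, H) G),
    -bracketSum (f ⟨(l, j + 1), by simp [← h]; ring⟩) x =
      dR E M j (f ⟨(l + 1, j), by simp [← h]; ring⟩ x) +
        varsigma (l + 2) • contractForm H G (k := l + 2) (j := j + 1) (by omega) σ x
  /-- For `k = n + 1`, `n = l + 1 ≥ 1`:
  `∑_{a<b} (-1)^{a+b+1} f_n([x_a, x_b], …) = ς(n+1) ι(v_{x₁} ∧ ⋯ ∧ v_{x_{n+1}}) σ`. -/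
  last : ∀ (l : ℕ) (h : l + 1 = n) (x : Fin (l + 2) → GroupLieAlgebra 𝓘(ℝ, H) G),
    -bracketSum (f ⟨(l, 0), by simp [← h]⟩) x =
      varsigma (n + 1) • contractForm H G (k := l + 2) (j := 0) (by omega) σ x
  /-- The last equation for `n = 0`, where the sum is empty. -/
  last_zero : ∀ (h : n = 0) (x : Fin 1 → GroupLieAlgebra 𝓘(ℝ, H) G),
    0 = varsigma (n + 1) • contractForm H G (k := 1) (j := 0) (by omega) σ x

/-- The family `f_k = ς(k) φ_k`. -/
def toMoment {n : ℤ} (φ : TotDeg E M H G n) : TotDeg E M H G n := fun q ↦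
  varsigma (q.1.1 + 1) • φ q

end Cone

end HomotopyMoment

end

open HomotopyMoment

/-!
# The cone of a Lie group action and homotopy moment maps

Both assertions are statements about the components, in `Λ^{k+1} 𝔤^* ⊗ Ω^j(M)`, of equations in the
cone.

**The cone is a complex.** `D ∘ D = 0` amounts to `d² = 0` on `Ω(M)^G`, to `d_tot² = 0`, and to the
fact that `σ ↦ σ̃` is a cochain map.

* `d_tot² = 0` needs `d_𝔤² = 0`, which is proved in `ceD_ceD` by Cartan calculus on alternating maps:
  with `θ_x = ι_x d_𝔤 + d_𝔤 ι_x` (which is `-ceAct`) one has `[θ_x, ι_y] = ι_{[x, y]}`, hence by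
  induction on the degree `θ` is a representation and commutes with `d_𝔤`, and then
  `ι_x d_𝔤² = d_𝔤² ι_x` reduces `d_𝔤² = 0` to a lower degree.
* `σ ↦ σ̃` is a cochain map because of `contractForm_dR`, which expresses
  `ι(v_{x₀} ∧ ⋯ ∧ v_{xₖ}) dτ` through `d ι(v_{x₀} ∧ ⋯ ∧ v_{xₖ}) τ`, `d_𝔤 τ_k` and the Lie derivatives
  `L_{v_{xᵢ}} τ`. It follows by induction on `k` from Cartan's formula and the relation
  `L_{v_x} ι(v_y) = ι(v_y) L_{v_x} + ι(v_{[x, y]})` (`lieGen_interiorGen`). For invariant forms the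
  Lie derivatives vanish (`lieGen_eq_zero_of_invariant`).

The geometric facts are proved in charts. `lieRep` is the usual coordinate expression of the Lie
derivative; Cartan's formula and the commutator with an interior product are computations with it,
and an invariant form has vanishing Lie derivative since mixed second derivatives of the action
commute. That `x ↦ v_x` is a Lie algebra homomorphism (`lieBracket_fieldRep_generator`) holds because
the left-invariant field of `x` and `v_x` are related by the orbit map `g ↦ g⁻¹ • p`, and brackets of
related vector fields are related (`lieBracket_of_related`).

**Closed elements are homotopy moment maps.** `D(σ[1], φ) = 0` says `dσ = 0` and `σ̃ = d_tot φ`. The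
components of the second equation, multiplied by `ς(k)`, are the equations of a homotopy moment map
for `f_k = ς(k) φ_k`, by the recursion `ς(k + 1) = (-1)^{k+1} ς(k)`.
-/

namespace HomotopyMoment

/-! ### Alternating maps: the Chevalley-Eilenberg differential squares to zero -/

section Algebra

variable {L V : Type*} [AddCommGroup L] [Module ℝ L] [AddCommGroup V] [Module ℝ V]

/-- The action of `f : L → L` on an alternating map as a derivation:
`∑ i, φ (u₀, …, f uᵢ, …)`. -/
def derivSum {k : ℕ} (f : L → L) (φ : L [⋀^Fin k]→ₗ[ℝ] V) (u : Fin k → L) : V :=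
  ∑ i, φ (Function.update u i (f (u i)))

lemma derivSum_vecCons {k : ℕ} (f : L → L) (φ : L [⋀^Fin (k + 1)]→ₗ[ℝ] V) (a : L)
    (u : Fin k → L) :
    derivSum f φ (Matrix.vecCons a u) =
      φ (Matrix.vecCons (f a) u) + derivSum f (φ.curryLeft a) u := by
  rw [derivSum, Fin.sum_univ_succ]
  congr 1
  · simp only [Matrix.vecCons, Fin.cons_zero, Fin.update_cons_zero]
  · simp only [derivSum, AlternatingMap.curryLeft_apply_apply, Matrix.vecCons, Fin.cons_succ,
      Fin.cons_update]

lemma map_update_eq_vecCons {k : ℕ} (φ : L [⋀^Fin (k + 1)]→ₗ[ℝ] V) (u : Fin (k + 1) → L)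
    (i : Fin (k + 1)) (a : L) :
    φ (Function.update u i a) = (-1 : ℝ) ^ (i : ℕ) • φ (Matrix.vecCons a (i.removeNth u)) := by
  rw [← Fin.insertNth_removeNth, AlternatingMap.map_insertNth]
  rcases Nat.even_or_odd (i : ℕ) with h | h <;> simp [h.neg_one_pow]

lemma derivSum_eq {k : ℕ} (f : L → L) (φ : L [⋀^Fin (k + 1)]→ₗ[ℝ] V) (u : Fin (k + 1) → L) :
    derivSum f φ u =
      ∑ i : Fin (k + 1), (-1 : ℝ) ^ (i : ℕ) • φ (Matrix.vecCons (f (u i)) (i.removeNth u)) :=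
  Finset.sum_congr rfl fun i _ ↦ map_update_eq_vecCons φ u i _

lemma alternatingMap_ext_curryLeft {k : ℕ} {φ ψ : L [⋀^Fin (k + 1)]→ₗ[ℝ] V}
    (h : ∀ x, φ.curryLeft x = ψ.curryLeft x) : φ = ψ := by
  ext u
  have := DFunLike.congr_fun (h (u 0)) (Fin.tail u)
  simpa [Matrix.vecCons] using this

end Algebra

section LieAlgebraCohomology

variable {L V : Type*} [LieRing L] [LieAlgebra ℝ L] [AddCommGroup V] [Module ℝ V]

lemma bracketSum_vecCons_zero (φ : L [⋀^Fin 1]→ₗ[ℝ] V) (a : L) (u : Fin 1 → L) :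
    bracketSum φ (Matrix.vecCons a u) = -derivSum (fun y ↦ ⁅a, y⁆) φ u := by
  have h : Finset.Ici (0 : Fin (0 + 1)) = {0} := rfl
  simp [bracketSum, derivSum_eq, h]

/-- Expansion of the bracket sum along its first argument, which makes the inductions below possible:
pairs containing the first index give the derivation action of `ad a`, the others the bracket sum of
`φ.curryLeft a`. -/
lemma bracketSum_vecCons_succ {k : ℕ} (φ : L [⋀^Fin (k + 2)]→ₗ[ℝ] V) (a : L)
    (u : Fin (k + 2) → L) :
    bracketSum φ (Matrix.vecCons a u) =
      -derivSum (fun y ↦ ⁅a, y⁆) φ u - bracketSum (φ.curryLeft a) u := by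
  rw [bracketSum, Fin.sum_univ_succ, sub_eq_add_neg, derivSum_eq, ← Finset.sum_neg_distrib]
  congr 1
  · have : Finset.Ici (0 : Fin (k + 1 + 1)) = Finset.univ := by ext; simp
    rw [this]
    refine Finset.sum_congr rfl fun j _ ↦ ?_
    simp only [Fin.castSucc_zero, Matrix.cons_val_zero, Matrix.cons_val_succ, Fin.removeNth_zero,
      Fin.val_zero, zero_add, pow_succ, mul_neg, mul_one, neg_smul]
    rfl
  · rw [bracketSum, ← Finset.sum_neg_distrib]
    refine Finset.sum_congr rfl fun i _ ↦ ?_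
    rw [Fin.sum_Ici_succ, ← Finset.sum_neg_distrib]
    refine Finset.sum_congr rfl fun j _ ↦ ?_
    have h1 : j.succ.removeNth (i.succ.castSucc.removeNth (Matrix.vecCons a u)) =
        Matrix.vecCons a (j.removeNth (i.castSucc.removeNth u)) := by
      funext l
      induction l using Fin.cases with
      | zero => simp [Fin.removeNth, Matrix.vecCons]
      | succ l => simp [Fin.removeNth, Matrix.vecCons]
    rw [h1, ← Fin.succ_castSucc, Matrix.cons_val_succ, Matrix.cons_val_succ,
      AlternatingMap.curryLeft_apply_apply]
    -- moving `a` back to the front gives the sign of a transposition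
    have h2 : φ (Matrix.vecCons ⁅u i.castSucc, u j.succ⁆
        (Matrix.vecCons a (j.removeNth (i.castSucc.removeNth u)))) =
        -φ (Matrix.vecCons a (Matrix.vecCons ⁅u i.castSucc, u j.succ⁆
          (j.removeNth (i.castSucc.removeNth u)))) := by
      rw [← φ.map_swap _ (show (0 : Fin (k + 2)) ≠ 1 by simp)]
      congr 1
      funext l
      refine Fin.cases ?_ (fun l ↦ Fin.cases ?_ (fun l ↦ ?_) l) l
      · simp
      · have : (Fin.succ 0 : Fin (k + 2)) = 1 := rfl
        simp [this]
      · have h3 : (l.succ.succ : Fin (k + 2)) ≠ 0 := Fin.succ_ne_zero _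
        have h4 : (l.succ.succ : Fin (k + 2)) ≠ 1 := by
          rw [← Fin.succ_zero_eq_one]
          exact fun h ↦ Fin.succ_ne_zero _ (Fin.succ_injective _ h)
        simp [Equiv.swap_apply_of_ne_of_ne h3 h4]
    rw [h2, ← smul_neg]
    simp only [Fin.val_succ, smul_neg, neg_inj]
    congr 1
    ring

variable (L V) in
/-- The Chevalley-Eilenberg differential with trivial coefficients, extended to `V = Λ^0 L^* ⊗ V`,
where it vanishes. -/
def ceD : ∀ k : ℕ, (L [⋀^Fin k]→ₗ[ℝ] V) →ₗ[ℝ] (L [⋀^Fin (k + 1)]→ₗ[ℝ] V)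
  | 0 => 0
  | k + 1 => dCE k

variable (V) in
/-- The coadjoint action of `L` on alternating maps up to sign,
`φ ↦ ∑ i, φ (u₀, …, [x, uᵢ], …)`, defined as `-(ι_x d_𝔤 + d_𝔤 ι_x)` so that it is visibly
an alternating map; `ceAct_apply` identifies the two. -/
def ceAct (x : L) : ∀ k : ℕ, (L [⋀^Fin k]→ₗ[ℝ] V) → (L [⋀^Fin k]→ₗ[ℝ] V)
  | 0, _ => 0
  | k + 1, φ => -((ceD L V (k + 1) φ).curryLeft x + ceD L V k (φ.curryLeft x))

lemma ceAct_apply (x : L) {k : ℕ} (φ : L [⋀^Fin k]→ₗ[ℝ] V) (u : Fin k → L) :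
    ceAct V x k φ u = derivSum (fun y ↦ ⁅x, y⁆) φ u := by
  match k with
  | 0 => simp [ceAct, derivSum]
  | 1 =>
    change -(bracketSum φ (Matrix.vecCons x u) + 0) = _
    rw [bracketSum_vecCons_zero, add_zero, neg_neg]
  | k + 2 =>
    change -(bracketSum φ (Matrix.vecCons x u) + bracketSum (φ.curryLeft x) u) = _
    rw [bracketSum_vecCons_succ]
    abel

lemma curryLeft_ceD_succ (x : L) {k : ℕ} (φ : L [⋀^Fin (k + 1)]→ₗ[ℝ] V) :
    (ceD L V (k + 1) φ).curryLeft x = -ceAct V x (k + 1) φ - ceD L V k (φ.curryLeft x) := by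
  rw [ceAct]
  abel

lemma ceAct_add (x : L) {k : ℕ} (φ ψ : L [⋀^Fin k]→ₗ[ℝ] V) :
    ceAct V x k (φ + ψ) = ceAct V x k φ + ceAct V x k ψ := by
  ext u
  simp [ceAct_apply, derivSum, Finset.sum_add_distrib]

lemma ceAct_neg (x : L) {k : ℕ} (φ : L [⋀^Fin k]→ₗ[ℝ] V) :
    ceAct V x k (-φ) = -ceAct V x k φ := by
  ext u
  simp [ceAct_apply, derivSum]

lemma ceAct_sub (x : L) {k : ℕ} (φ ψ : L [⋀^Fin k]→ₗ[ℝ] V) :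
    ceAct V x k (φ - ψ) = ceAct V x k φ - ceAct V x k ψ := by
  rw [sub_eq_add_neg, ceAct_add, ceAct_neg, sub_eq_add_neg]

lemma curryLeft_ceAct (x y : L) {k : ℕ} (φ : L [⋀^Fin (k + 1)]→ₗ[ℝ] V) :
    (ceAct V x (k + 1) φ).curryLeft y =
      φ.curryLeft ⁅x, y⁆ + ceAct V x k (φ.curryLeft y) := by
  ext u
  rw [AlternatingMap.curryLeft_apply_apply, ceAct_apply, derivSum_vecCons,
    AlternatingMap.add_apply, ceAct_apply]
  rfl

lemma ceAct_lie (x y : L) {k : ℕ} (φ : L [⋀^Fin k]→ₗ[ℝ] V) :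
    ceAct V ⁅x, y⁆ k φ = ceAct V y k (ceAct V x k φ) - ceAct V x k (ceAct V y k φ) := by
  induction k with
  | zero => simp [ceAct]
  | succ k ih =>
    refine alternatingMap_ext_curryLeft fun z ↦ ?_
    have hsub (α β : L [⋀^Fin (k + 1)]→ₗ[ℝ] V) :
      (α - β).curryLeft z = α.curryLeft z - β.curryLeft z := rfl
    simp only [hsub, curryLeft_ceAct, ceAct_add, ih, lie_lie, map_sub]
    abel

lemma ceAct_ceD (x : L) {k : ℕ} (φ : L [⋀^Fin k]→ₗ[ℝ] V) :
    ceAct V x (k + 1) (ceD L V k φ) = ceD L V k (ceAct V x k φ) := by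
  induction k with
  | zero =>
    ext u
    simp [ceAct_apply, derivSum, ceD]
  | succ k ih =>
    refine alternatingMap_ext_curryLeft fun y ↦ ?_
    rw [curryLeft_ceAct, curryLeft_ceD_succ, curryLeft_ceD_succ, curryLeft_ceD_succ, ceAct_sub,
      ceAct_neg, curryLeft_ceAct, map_add, ih, ceAct_lie]
    abel

/-- The Chevalley-Eilenberg differential squares to zero. -/
theorem ceD_ceD {k : ℕ} (φ : L [⋀^Fin k]→ₗ[ℝ] V) : ceD L V (k + 1) (ceD L V k φ) = 0 := by
  induction k with
  | zero => exact map_zero _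
  | succ k ih =>
    refine alternatingMap_ext_curryLeft fun x ↦ ?_
    rw [curryLeft_ceD_succ, curryLeft_ceD_succ, ceAct_ceD, map_sub, map_neg, ih]
    simp

end LieAlgebraCohomology

/-! ### The Lie derivative in coordinates -/

section VectorSpace

variable {E : Type*} [NormedAddCommGroup E] [NormedSpace ℝ E]

/-- The coordinate expression `(L_W s)(y) u = D_{W(y)} s (u) + ∑ i, s(y) (…, DW(y) uᵢ, …)` of the
Lie derivative of the form `s` along the vector field `W`. -/
noncomputable def lieRep {k : ℕ} (W : E → E) (s : E → E [⋀^Fin k]→L[ℝ] ℝ) (y : E)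
    (u : Fin k → E) : ℝ :=
  fderiv ℝ s y (W y) u + derivSum (fderiv ℝ W y) (s y).toAlternatingMap u

lemma differentiableAt_curryLeft {k : ℕ} {W : E → E} {s : E → E [⋀^Fin (k + 1)]→L[ℝ] ℝ} {y : E}
    (hs : DifferentiableAt ℝ s y) (hW : DifferentiableAt ℝ W y) :
    DifferentiableAt ℝ (fun z ↦ (s z).curryLeft (W z)) y :=
  ((contDiff_curryLeft.differentiable (by simp)).differentiableAt.comp y hs).clm_apply hW

lemma fderiv_curryLeft {k : ℕ} {W : E → E} {s : E → E [⋀^Fin (k + 1)]→L[ℝ] ℝ} {y : E}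
    (hs : DifferentiableAt ℝ s y) (hW : DifferentiableAt ℝ W y) (a : E) (u : Fin k → E) :
    fderiv ℝ (fun z ↦ (s z).curryLeft (W z)) y a u =
      fderiv ℝ s y a (Matrix.vecCons (W y) u) + s y (Matrix.vecCons (fderiv ℝ W y a) u) := by
  rw [← fderiv_continuousAlternatingMap_apply_const_apply (differentiableAt_curryLeft hs hW)]
  let g : Fin (k + 1) → E → E := fun i z ↦ (Matrix.vecCons (W z) u : Fin (k + 1) → E) i
  have hg : ∀ i, DifferentiableAt ℝ (g i) y := fun i ↦ by
    induction i using Fin.cases with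
    | zero => exact hW
    | succ i => exact differentiableAt_const _
  have h := fderiv_continuousAlternatingMap_apply_apply hs hg a
  refine h.trans (congrArg₂ _ rfl ?_)
  rw [Fin.sum_univ_succ, Finset.sum_eq_zero, add_zero]
  · congr 1
    exact Fin.update_cons_zero _ _ _
  · intro i _
    have : fderiv ℝ (g i.succ) y = 0 := fderiv_const_apply _
    rw [this]
    exact (s y).map_coord_zero i.succ (by simp)

lemma extDeriv_zero_vecCons {s : E → E [⋀^Fin 0]→L[ℝ] ℝ} {y : E}
    (hs : DifferentiableAt ℝ s y) (W : E → E) (u : Fin 0 → E) :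
    extDeriv s y (Matrix.vecCons (W y) u) = lieRep W s y u := by
  rw [extDeriv_apply hs, lieRep, derivSum, Fin.sum_univ_succ]
  simp [fderiv_continuousAlternatingMap_apply_const_apply hs, Matrix.vecCons]

/-- Cartan's magic formula `L_W = ι_W d + d ι_W` in coordinates. -/
lemma extDeriv_vecCons_add {k : ℕ} {W : E → E} {s : E → E [⋀^Fin (k + 1)]→L[ℝ] ℝ} {y : E}
    (hs : DifferentiableAt ℝ s y) (hW : DifferentiableAt ℝ W y) (u : Fin (k + 1) → E) :
    extDeriv s y (Matrix.vecCons (W y) u) + extDeriv (fun z ↦ (s z).curryLeft (W z)) y u =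
      lieRep W s y u := by
  rw [extDeriv_apply hs, extDeriv_apply (differentiableAt_curryLeft hs hW), Fin.sum_univ_succ,
    lieRep, derivSum_eq, add_assoc, ← Finset.sum_add_distrib]
  congr 1
  · simp [fderiv_continuousAlternatingMap_apply_const_apply hs, Matrix.vecCons]
  · refine Finset.sum_congr rfl fun i _ ↦ ?_
    have h1 : i.succ.removeNth (Matrix.vecCons (W y) u) =
        Matrix.vecCons (W y) (i.removeNth u) := by
      funext l
      induction l using Fin.cases with
      | zero => simp [Fin.removeNth, Matrix.vecCons]
      | succ l => simp [Fin.removeNth, Matrix.vecCons]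
    rw [h1, fderiv_continuousAlternatingMap_apply_const_apply hs,
      fderiv_continuousAlternatingMap_apply_const_apply (differentiableAt_curryLeft hs hW),
      fderiv_curryLeft hs hW]
    simp only [Fin.val_succ, Matrix.cons_val_succ, pow_succ, smul_eq_mul, zsmul_eq_mul]
    push_cast
    simp only [ContinuousAlternatingMap.coe_toAlternatingMap]
    ring

/-- `L_V ι_W = ι_W L_V + ι_{[V, W]}` in coordinates. -/
lemma lieRep_curryLeft {k : ℕ} {V W : E → E} {s : E → E [⋀^Fin (k + 1)]→L[ℝ] ℝ} {y : E}
    (hs : DifferentiableAt ℝ s y) (hW : DifferentiableAt ℝ W y) (u : Fin k → E) :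
    lieRep V (fun z ↦ (s z).curryLeft (W z)) y u =
      lieRep V s y (Matrix.vecCons (W y) u) +
        s y (Matrix.vecCons (VectorField.lieBracket ℝ V W y) u) := by
  rw [lieRep, lieRep, derivSum_vecCons, fderiv_curryLeft hs hW, VectorField.lieBracket,
    ContinuousAlternatingMap.map_vecCons_sub]
  simp only [ContinuousAlternatingMap.coe_toAlternatingMap]
  have : ((s y).curryLeft (W y)).toAlternatingMap =
    ((s y).toAlternatingMap).curryLeft (W y) := rfl
  rw [this]
  ring

/-- If a form `s` is preserved by the maps `Φ(t, ·)` of a one-parameter family through the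
identity, then its Lie derivative along the velocity field `V` of the family vanishes. The maps need
not form a flow: only the first order in `t` matters. -/
lemma lieRep_eq_zero_of_pullback_eq {k : ℕ} {s : E → E [⋀^Fin k]→L[ℝ] ℝ} {Φ : ℝ × E → E} {V : E → E}
    {y₀ : E} (hΦ : ContDiffAt ℝ ∞ Φ (0, y₀)) (hid : ∀ᶠ y in 𝓝 y₀, Φ (0, y) = y)
    (hV : ∀ᶠ y in 𝓝 y₀, V y = fderiv ℝ Φ (0, y) (1, 0))
    (hs : DifferentiableAt ℝ s y₀)
    (hinv : ∀ᶠ t : ℝ in 𝓝 0, s y₀ =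
      (s (Φ (t, y₀))).compContinuousLinearMap (fderiv ℝ (fun y ↦ Φ (t, y)) y₀))
    (u : Fin k → E) : lieRep V s y₀ u = 0 := by
  have hΦd : DifferentiableAt ℝ Φ (0, y₀) := hΦ.differentiableAt (by simp)
  have hΦev : ∀ᶠ q in 𝓝 ((0 : ℝ), y₀), DifferentiableAt ℝ Φ q := by
    have := (hΦ.of_le (m := 1) (by simp)).eventually (by simp)
    exact this.mono fun q hq ↦ hq.differentiableAt (by simp)
  have hD : DifferentiableAt ℝ (fderiv ℝ Φ) (0, y₀) :=
    (hΦ.fderiv_right (m := ∞) (by simp)).differentiableAt (by simp)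
  have hsymm : IsSymmSndFDerivAt ℝ Φ (0, y₀) :=
    hΦ.isSymmSndFDerivAt (by simpa using (ENat.LEInfty.out : (2 : ℕ∞ω) ≤ ∞))
  have hΦ0 : Φ (0, y₀) = y₀ := hid.self_of_nhds
  -- the two partial inclusions
  have hinl : HasFDerivAt (fun t : ℝ ↦ (t, y₀)) (ContinuousLinearMap.inl ℝ ℝ E) 0 :=
    hasFDerivAt_prodMk_left 0 y₀
  have hinr (t : ℝ) (y : E) : HasFDerivAt (fun y : E ↦ (t, y)) (ContinuousLinearMap.inr ℝ ℝ E) y :=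
    hasFDerivAt_prodMk_right t y
  have hct : ContinuousAt (fun t : ℝ ↦ (t, y₀)) 0 := hinl.continuousAt
  have hA : ∀ᶠ t : ℝ in 𝓝 0, fderiv ℝ (fun y ↦ Φ (t, y)) y₀ =
      (fderiv ℝ Φ (t, y₀)).comp (ContinuousLinearMap.inr ℝ ℝ E) := by
    filter_upwards [hct.eventually hΦev] with t ht
    exact (ht.hasFDerivAt.comp y₀ (hinr t y₀)).fderiv
  have hA0 : (fderiv ℝ Φ (0, y₀)).comp (ContinuousLinearMap.inr ℝ ℝ E) =
      ContinuousLinearMap.id ℝ E := by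
    rw [← hA.self_of_nhds, Filter.EventuallyEq.fderiv_eq (f := id) hid, fderiv_id]
  -- the derivative of `V` is a mixed second derivative of `Φ`
  have hDV (w : E) : fderiv ℝ V y₀ w = fderiv ℝ (fderiv ℝ Φ) (0, y₀) (1, 0) (0, w) := by
    have h1 : HasFDerivAt (fun y : E ↦ fderiv ℝ Φ (0, y))
        ((fderiv ℝ (fderiv ℝ Φ) (0, y₀)).comp (ContinuousLinearMap.inr ℝ ℝ E)) y₀ :=
      HasFDerivAt.comp (g := fderiv ℝ Φ) y₀ hD.hasFDerivAt (hinr 0 y₀)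
    have h2 := h1.clm_apply (hasFDerivAt_const ((1 : ℝ), (0 : E)) y₀)
    rw [Filter.EventuallyEq.fderiv_eq hV, h2.fderiv, hsymm.eq]
    simp
  have hB : HasFDerivAt (fun t : ℝ ↦ (fderiv ℝ Φ (t, y₀)).comp (ContinuousLinearMap.inr ℝ ℝ E))
      (((ContinuousLinearMap.compL ℝ E (ℝ × E) E).flip (ContinuousLinearMap.inr ℝ ℝ E)).comp
        ((fderiv ℝ (fderiv ℝ Φ) (0, y₀)).comp (ContinuousLinearMap.inl ℝ ℝ E))) 0 := by
    have h1 : HasFDerivAt (fun t : ℝ ↦ fderiv ℝ Φ (t, y₀))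
        ((fderiv ℝ (fderiv ℝ Φ) (0, y₀)).comp (ContinuousLinearMap.inl ℝ ℝ E)) 0 :=
      HasFDerivAt.comp (g := fderiv ℝ Φ) 0 hD.hasFDerivAt hinl
    exact HasFDerivAt.comp (g := (ContinuousLinearMap.compL ℝ E (ℝ × E) E).flip
      (ContinuousLinearMap.inr ℝ ℝ E)) 0 (ContinuousLinearMap.hasFDerivAt _) h1
  have hS : HasFDerivAt (fun t : ℝ ↦ s (Φ (t, y₀)))
      ((fderiv ℝ s y₀).comp ((fderiv ℝ Φ (0, y₀)).comp (ContinuousLinearMap.inl ℝ ℝ E))) 0 := by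
    have h1 : HasFDerivAt (fun t : ℝ ↦ Φ (t, y₀))
        ((fderiv ℝ Φ (0, y₀)).comp (ContinuousLinearMap.inl ℝ ℝ E)) 0 :=
      HasFDerivAt.comp (g := Φ) 0 hΦd.hasFDerivAt hinl
    have h2 : HasFDerivAt s (fderiv ℝ s y₀) (Φ (0, y₀)) := by
      rw [hΦ0]; exact hs.hasFDerivAt
    exact HasFDerivAt.comp (g := s) 0 h2 h1
  have hpull := hS.continuousAlternatingMapCompContinuousLinearMap hB
  have hconst : HasFDerivAt (fun t : ℝ ↦ (s (Φ (t, y₀))).compContinuousLinearMap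
      ((fderiv ℝ Φ (t, y₀)).comp (ContinuousLinearMap.inr ℝ ℝ E)))
      (0 : ℝ →L[ℝ] E [⋀^Fin k]→L[ℝ] ℝ) (0 : ℝ) := by
    refine (hasFDerivAt_const (s y₀) (0 : ℝ)).congr_of_eventuallyEq ?_
    filter_upwards [hA, hinv] with t h1 h2
    rw [h2, h1]
  have key := congrArg (fun A : ℝ →L[ℝ] (E [⋀^Fin k]→L[ℝ] ℝ) ↦ A 1 u) (hpull.unique hconst)
  rw [lieRep, hV.self_of_nhds]
  refine Eq.trans ?_ key
  rw [hA0, hΦ0, add_apply, ContinuousAlternatingMap.add_apply]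
  congr 1
  simp only [ContinuousLinearMap.comp_apply, ContinuousLinearMap.inl_apply,
    ContinuousAlternatingMap.fderivCompContinuousLinearMap_apply]
  refine Finset.sum_congr rfl fun i _ ↦ congrArg (s y₀) (funext fun j ↦ ?_)
  rcases eq_or_ne j i with rfl | hj
  · simp [hDV]
  · simp [hj]

end VectorSpace

/-! ### Vector fields in charts and the bracket of generators -/

/-- If the vector fields `V, W` are `F`-related to `V', W'`, then so are their Lie brackets. -/
lemma lieBracket_of_related {E₁ E₂ : Type*} [NormedAddCommGroup E₁] [NormedSpace ℝ E₁]
    [NormedAddCommGroup E₂] [NormedSpace ℝ E₂] {F : E₁ → E₂} {V W : E₁ → E₁} {V' W' : E₂ → E₂}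
    {h : E₁} (hF : ContDiffAt ℝ ∞ F h) (hV : DifferentiableAt ℝ V h)
    (hW : DifferentiableAt ℝ W h) (hV' : DifferentiableAt ℝ V' (F h))
    (hW' : DifferentiableAt ℝ W' (F h))
    (hVV' : ∀ᶠ z in 𝓝 h, V' (F z) = fderiv ℝ F z (V z))
    (hWW' : ∀ᶠ z in 𝓝 h, W' (F z) = fderiv ℝ F z (W z)) :
    VectorField.lieBracket ℝ V' W' (F h) = fderiv ℝ F h (VectorField.lieBracket ℝ V W h) := by
  have hD : DifferentiableAt ℝ (fderiv ℝ F) h :=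
    (hF.fderiv_right (m := ∞) (by simp)).differentiableAt (by simp)
  have hsymm : IsSymmSndFDerivAt ℝ F h :=
    hF.isSymmSndFDerivAt (by simpa using (ENat.LEInfty.out : (2 : ℕ∞ω) ≤ ∞))
  have aux {U : E₁ → E₁} {U' : E₂ → E₂} (hU : DifferentiableAt ℝ U h)
      (hU' : DifferentiableAt ℝ U' (F h)) (hUU' : ∀ᶠ z in 𝓝 h, U' (F z) = fderiv ℝ F z (U z))
      (w : E₁) : fderiv ℝ U' (F h) (fderiv ℝ F h w) =
        fderiv ℝ F h (fderiv ℝ U h w) + fderiv ℝ (fderiv ℝ F) h w (U h) := by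
    have h1 := hU'.hasFDerivAt.comp h (hF.differentiableAt (by simp)).hasFDerivAt
    have h2 := hD.hasFDerivAt.clm_apply hU.hasFDerivAt
    have h3 := h1.congr_of_eventuallyEq (f₁ := fun z ↦ fderiv ℝ F z (U z))
      (hUU'.mono fun z hz ↦ hz.symm)
    simpa using DFunLike.congr_fun (h3.unique h2) w
  rw [VectorField.lieBracket, VectorField.lieBracket, hVV'.self_of_nhds, hWW'.self_of_nhds,
    aux hV hV' hVV', aux hW hW' hWW', hsymm.eq (V h) (W h), map_sub]
  abel

section Charts

variable {E : Type*} [NormedAddCommGroup E] [NormedSpace ℝ E] [CompleteSpace E]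
  {M : Type*} [TopologicalSpace M] [ChartedSpace E M] [IsManifold 𝓘(ℝ, E) ∞ M]

/-- The expression of a vector field in the preferred chart at `x₀`. -/
noncomputable def fieldRep (x₀ : M) (X : ∀ p : M, TangentSpace 𝓘(ℝ, E) p) : E → E :=
  VectorField.mpullback 𝓘(ℝ, E) 𝓘(ℝ, E) (extChartAt 𝓘(ℝ, E) x₀).symm X

lemma mfderiv_symm_fieldRep {x₀ : M} {y : E} (hy : y ∈ (extChartAt 𝓘(ℝ, E) x₀).target)
    (X : ∀ p : M, TangentSpace 𝓘(ℝ, E) p) :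
    mfderiv 𝓘(ℝ, E) 𝓘(ℝ, E) (extChartAt 𝓘(ℝ, E) x₀).symm y (fieldRep (E := E) x₀ X y) =
      X ((extChartAt 𝓘(ℝ, E) x₀).symm y) :=
  (isInv hy).self_apply_inverse _

lemma differentiableAt_fieldRep {x₀ : M} {y : E} (hy : y ∈ (extChartAt 𝓘(ℝ, E) x₀).target)
    {X : ∀ p : M, TangentSpace 𝓘(ℝ, E) p}
    (hX : ContMDiff 𝓘(ℝ, E) 𝓘(ℝ, E).tangent 1 (fun p ↦ (⟨p, X p⟩ : TangentBundle 𝓘(ℝ, E) M))) :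
    DifferentiableAt ℝ (fieldRep x₀ X) y := by
  have : ContDiffAt ℝ 1 (fieldRep x₀ X) y :=
    contMDiffAt_vectorSpace_iff_contDiffAt.1 <| ContMDiffAt.mpullback_vectorField_preimage
      (n := ∞) (hX _) (mdiff_chart_symm hy)
      (isInv hy) (by rw [one_add_one_eq_two]; exact ENat.LEInfty.out)
  exact this.differentiableAt (by simp)

lemma IsSmoothField.differentiableAt_fieldRep {x₀ : M} {y : E}
    (hy : y ∈ (extChartAt 𝓘(ℝ, E) x₀).target)
    {X : ∀ p : M, TangentSpace 𝓘(ℝ, E) p} (hX : IsSmoothField X) :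
    DifferentiableAt ℝ (fieldRep x₀ X) y :=
  HomotopyMoment.differentiableAt_fieldRep hy (hX.of_le (by simp))

lemma localRep_rawInterior {k : ℕ} {x₀ : M} {y : E} (hy : y ∈ (extChartAt 𝓘(ℝ, E) x₀).target)
    (X : ∀ p : M, TangentSpace 𝓘(ℝ, E) p) (σ : RawForm E M (k + 1)) :
    localRep x₀ (rawInterior X σ) y = (localRep x₀ σ y).curryLeft (fieldRep (E := E) x₀ X y) := by
  set φ := extChartAt 𝓘(ℝ, E) x₀
  ext v
  change σ (φ.symm y) (Matrix.vecCons (X (φ.symm y))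
      (fun i ↦ mfderiv 𝓘(ℝ, E) 𝓘(ℝ, E) φ.symm y (v i))) =
    σ (φ.symm y) (fun i ↦ mfderiv 𝓘(ℝ, E) 𝓘(ℝ, E) φ.symm y
      (Matrix.vecCons (fieldRep (E := E) x₀ X y) v i))
  congr 1
  funext i
  induction i using Fin.cases with
  | zero => exact (mfderiv_symm_fieldRep hy X).symm
  | succ i => rfl

/-- A form is determined by the values of its chart expressions at the centres of the charts. -/
lemma rawForm_ext_localRep {k : ℕ} {σ η : RawForm E M k}
    (h : ∀ p, localRep p σ (extChartAt 𝓘(ℝ, E) p p) = localRep p η (extChartAt 𝓘(ℝ, E) p p)) :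
    σ = η := by
  funext p
  set φ := extChartAt 𝓘(ℝ, E) p
  have hy : φ p ∈ φ.target := mem_extChartAt_target p
  have hpp : φ.symm (φ p) = p := φ.left_inv (mem_extChartAt_source p)
  ext v
  let A := mfderiv 𝓘(ℝ, E) 𝓘(ℝ, E) φ.symm (φ p)
  have hA : ∀ w : E, A (A.inverse w) = w := fun w ↦ (isInv hy).self_apply_inverse w
  have h1 := DFunLike.congr_fun (h p) (fun i ↦ (A.inverse (v i) : E))
  change σ (φ.symm (φ p)) (fun i ↦ A (A.inverse (v i))) =
    η (φ.symm (φ p)) (fun i ↦ A (A.inverse (v i))) at h1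
  have h2 : (fun i ↦ A (A.inverse (v i))) = v := funext fun i ↦ hA (v i)
  exact (form_congr σ hpp.symm v).trans (((congrArg (σ (φ.symm (φ p))) h2).symm.trans h1).trans
    ((congrArg (η (φ.symm (φ p))) h2).trans (form_congr η hpp v)))

variable {H : Type*} [NormedAddCommGroup H] [NormedSpace ℝ H] [CompleteSpace H]
  {G : Type*} [TopologicalSpace G] [ChartedSpace H G] [Group G] [LieGroup 𝓘(ℝ, H) ∞ G]
  [MulAction G M] [ContMDiffSMul 𝓘(ℝ, H) 𝓘(ℝ, E) ∞ G M]

lemma fieldRep_mulInvariantVectorField_one (x : GroupLieAlgebra 𝓘(ℝ, H) G) :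
    fieldRep (1 : G) (mulInvariantVectorField x) (extChartAt 𝓘(ℝ, H) (1 : G) 1) = x := by
  have h1 := mfderivWithin_extChartAt_symm_inverse_apply (I := 𝓘(ℝ, H)) (x := (1 : G)) x
  rw [ModelWithCorners.range_eq_univ, mfderivWithin_univ] at h1
  refine Eq.trans ?_ h1
  have h2 : ∀ g : G, g = 1 → (mulInvariantVectorField x g : H) = x := by
    rintro _ rfl
    have h3 : ∀ f : G → G, f = id → (mfderiv 𝓘(ℝ, H) 𝓘(ℝ, H) f 1 x : H) = x := by
      rintro _ rfl
      exact DFunLike.congr_fun (mfderiv_id (I := 𝓘(ℝ, H)) (x := (1 : G))) x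
    exact h3 _ (funext one_mul)
  exact congrArg (mfderiv 𝓘(ℝ, H) 𝓘(ℝ, H) (extChartAt 𝓘(ℝ, H) (1 : G)).symm
    (extChartAt 𝓘(ℝ, H) (1 : G) 1)).inverse (h2 _ (extChartAt_to_inv _))

/-- The bracket of the Lie algebra, computed in the chart at the identity. -/
lemma lieBracket_fieldRep_mulInvariantVectorField (x y : GroupLieAlgebra 𝓘(ℝ, H) G) :
    VectorField.lieBracket ℝ (fieldRep (1 : G) (mulInvariantVectorField x))
      (fieldRep (1 : G) (mulInvariantVectorField y)) (extChartAt 𝓘(ℝ, H) (1 : G) 1) = ⁅x, y⁆ := by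
  rw [GroupLieAlgebra.bracket_def, ← VectorField.mlieBracketWithin_univ,
    VectorField.mlieBracketWithin_apply, mfderiv_extChartAt_self]
  refine Eq.trans ?_ (DFunLike.congr_fun (ContinuousLinearMap.inverse_id (R := ℝ) (M := H)) _).symm
  simp only [fieldRep, ModelWithCorners.range_eq_univ, Set.preimage_univ, Set.inter_univ,
    VectorField.mpullbackWithin_univ]
  exact (congrFun VectorField.lieBracketWithin_univ _).symm

variable (E) in
/-- The derivative of the orbit map `g ↦ g⁻¹ • p` takes the left-invariant vector field of `x` to
the generator of `x`. -/
lemma mfderiv_orbit_mulInvariantVectorField (p : M) (x : GroupLieAlgebra 𝓘(ℝ, H) G) (g : G) :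
    mfderiv 𝓘(ℝ, H) 𝓘(ℝ, E) (fun g : G ↦ g⁻¹ • p) g (mulInvariantVectorField x g) =
      generator (E := E) x (g⁻¹ • p) := by
  have h1 : ContMDiff 𝓘(ℝ, H) 𝓘(ℝ, E) ∞ (fun g : G ↦ g⁻¹ • p) :=
    ContMDiff.smul (I := 𝓘(ℝ, H)) contMDiff_id.inv contMDiff_const
  have h2 : ContMDiff 𝓘(ℝ, H) 𝓘(ℝ, H) ∞ (fun h : G ↦ g * h) := contMDiff_mul_left
  have h3 : (fun g : G ↦ g⁻¹ • p) ∘ (fun h : G ↦ g * h) = fun h : G ↦ h⁻¹ • (g⁻¹ • p) := by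
    funext h
    simp [mul_smul]
  have h4 := mfderiv_comp_of_eq (I := 𝓘(ℝ, H)) (I' := 𝓘(ℝ, H)) (I'' := 𝓘(ℝ, E))
    (x := (1 : G)) (y := g) (g := fun g : G ↦ g⁻¹ • p) (f := fun h : G ↦ g * h)
    ((h1 g).mdifferentiableAt (by simp)) ((h2 1).mdifferentiableAt (by simp)) (mul_one g)
  rw [h3] at h4
  -- `g * 1 = g` only propositionally: both tangent spaces are read as copies of the model space
  have h5 : ∀ g' : G, g' = g → ∀ v : H,
      (mfderiv 𝓘(ℝ, H) 𝓘(ℝ, E) (fun g : G ↦ g⁻¹ • p) g v : E) =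
        mfderiv 𝓘(ℝ, H) 𝓘(ℝ, E) (fun g : G ↦ g⁻¹ • p) g' v := by
    rintro _ rfl _
    rfl
  exact (h5 _ (mul_one g) _).trans (DFunLike.congr_fun h4 x).symm

/-- `x ↦ v_x` is a homomorphism of Lie algebras, in the chart at `p`. -/
lemma lieBracket_fieldRep_generator (p : M) (x y : GroupLieAlgebra 𝓘(ℝ, H) G) :
    VectorField.lieBracket ℝ (fieldRep p (generator (E := E) x))
        (fieldRep p (generator (E := E) y)) (extChartAt 𝓘(ℝ, E) p p) =
      fieldRep p (generator (E := E) ⁅x, y⁆) (extChartAt 𝓘(ℝ, E) p p) := by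
  set φ := extChartAt 𝓘(ℝ, E) p
  set ψ := extChartAt 𝓘(ℝ, H) (1 : G)
  let o : G → M := fun g ↦ g⁻¹ • p
  -- the orbit map in the charts
  let F : H → E := φ ∘ o ∘ ψ.symm
  have ho : ContMDiff 𝓘(ℝ, H) 𝓘(ℝ, E) ∞ o :=
    ContMDiff.smul (I := 𝓘(ℝ, H)) contMDiff_id.inv contMDiff_const
  have hy0 : ψ 1 ∈ ψ.target := mem_extChartAt_target (I := 𝓘(ℝ, H)) (1 : G)
  have ho1 : o (ψ.symm (ψ 1)) = p := by
    rw [ψ.left_inv (mem_extChartAt_source (I := 𝓘(ℝ, H)) (1 : G))]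
    simp [o]
  have hF1 : F (ψ 1) = φ p := by simp only [F, Function.comp_apply, ho1]
  have hsrc : ∀ᶠ z in 𝓝 (ψ 1), z ∈ ψ.target ∧ o (ψ.symm z) ∈ φ.source := by
    have hc : ContinuousAt (o ∘ ψ.symm) (ψ 1) :=
      ContinuousAt.comp (g := o) ho.continuous.continuousAt (mdiff_chart_symm hy0).continuousAt
    have h1 : ∀ᶠ z in 𝓝 (ψ 1), z ∈ ψ.target :=
      (isOpen_extChartAt_target (I := 𝓘(ℝ, H)) (1 : G)).mem_nhds hy0
    refine h1.and (hc ((isOpen_extChartAt_source p).mem_nhds ?_))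
    rw [Function.comp_apply, ho1]
    exact mem_extChartAt_source p
  have hoψ {z : H} (hz : z ∈ ψ.target) : ContMDiffAt 𝓘(ℝ, H) 𝓘(ℝ, E) ∞ (o ∘ ψ.symm) z :=
    ContMDiffAt.comp (g := o) (f := ψ.symm) _ (ho _) (mdiff_chart_symm hz)
  have hF {z : H} (hz : z ∈ ψ.target) (hz' : o (ψ.symm z) ∈ φ.source) : ContDiffAt ℝ ∞ F z :=
    contMDiffAt_iff_contDiffAt.1 <|
      ContMDiffAt.comp (I' := 𝓘(ℝ, E)) (g := φ) (f := o ∘ ψ.symm) _ (mdiff_chart hz') (hoψ hz)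
  have hrel (w : GroupLieAlgebra 𝓘(ℝ, H) G) : ∀ᶠ z in 𝓝 (ψ 1),
      fieldRep p (generator (E := E) w) (F z) =
        fderiv ℝ F z (fieldRep (1 : G) (mulInvariantVectorField w) z) := by
    filter_upwards [hsrc.eventually_nhds] with z hz
    obtain ⟨hz1, hz2⟩ := hz.self_of_nhds
    have hFt : F z ∈ φ.target := φ.map_source hz2
    have hev : φ.symm ∘ F =ᶠ[𝓝 z] o ∘ ψ.symm := hz.mono fun z' hz' ↦ φ.left_inv hz'.2
    have key : (mfderiv 𝓘(ℝ, E) 𝓘(ℝ, E) φ.symm (F z)).comp (mfderiv 𝓘(ℝ, H) 𝓘(ℝ, E) F z) =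
        (mfderiv 𝓘(ℝ, H) 𝓘(ℝ, E) o (ψ.symm z)).comp (mfderiv 𝓘(ℝ, H) 𝓘(ℝ, H) ψ.symm z) := by
      rw [← mfderiv_comp z ((mdiff_chart_symm hFt).mdifferentiableAt (by simp))
          ((hF hz1 hz2).contMDiffAt.mdifferentiableAt (by simp)),
        ← mfderiv_comp z ((ho _).mdifferentiableAt (by simp))
          ((mdiff_chart_symm hz1).mdifferentiableAt (by simp))]
      exact hev.mfderiv_eq
    rw [mfderiv_eq_fderiv] at key
    -- it suffices to compare the images under the derivative of `φ⁻¹`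
    apply (isInv hFt).injective
    refine (mfderiv_symm_fieldRep hFt _).trans ?_
    refine Eq.trans ?_
      (DFunLike.congr_fun key (fieldRep (1 : G) (mulInvariantVectorField w) z)).symm
    have h1 := mfderiv_symm_fieldRep hz1 (mulInvariantVectorField w)
    have h2 := mfderiv_orbit_mulInvariantVectorField E p w (ψ.symm z)
    have h3 : ∀ q : M, q = o (ψ.symm z) →
        (generator (E := E) w q : E) = generator (E := E) w (o (ψ.symm z)) := by
      rintro _ rfl
      rfl
    refine (h3 _ (φ.left_inv hz2)).trans (h2.symm.trans ?_)
    exact congrArg (mfderiv 𝓘(ℝ, H) 𝓘(ℝ, E) o (ψ.symm z)) h1.symm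
  have hVd (w : GroupLieAlgebra 𝓘(ℝ, H) G) :
      DifferentiableAt ℝ (fieldRep (1 : G) (mulInvariantVectorField w)) (ψ 1) :=
    differentiableAt_fieldRep hy0 ((contMDiff_mulInvariantVectorField w).of_le
      (le_trans one_le_two le_minSmoothness))
  have hWd (w : GroupLieAlgebra 𝓘(ℝ, H) G) :
      DifferentiableAt ℝ (fieldRep p (generator (E := E) w)) (F (ψ 1)) := by
    rw [hF1]
    exact (isSmoothField_generator w).differentiableAt_fieldRep (mem_extChartAt_target p)
  have h := lieBracket_of_related (hF hy0 hsrc.self_of_nhds.2) (hVd x) (hVd y) (hWd x) (hWd y)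
    (hrel x) (hrel y)
  rw [hF1, lieBracket_fieldRep_mulInvariantVectorField] at h
  have h' := (hrel ⁅x, y⁆).self_of_nhds
  rw [hF1, fieldRep_mulInvariantVectorField_one] at h'
  exact h.trans h'.symm

end Charts

/-! ### Cartan calculus for the generators of an action -/

lemma lieRep_congr {E : Type*} [NormedAddCommGroup E] [NormedSpace ℝ E] {k : ℕ} {W : E → E}
    {s s' : E → E [⋀^Fin k]→L[ℝ] ℝ} {y : E} (h : s =ᶠ[𝓝 y] s') (u : Fin k → E) :
    lieRep W s y u = lieRep W s' y u := by
  rw [lieRep, lieRep, h.fderiv_eq, h.self_of_nhds]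

section Cartan

variable {E : Type*} [NormedAddCommGroup E] [NormedSpace ℝ E] [CompleteSpace E]
  {M : Type*} [TopologicalSpace M] [ChartedSpace E M] [IsManifold 𝓘(ℝ, E) ∞ M]
  {H : Type*} [NormedAddCommGroup H] [NormedSpace ℝ H]
  {G : Type*} [TopologicalSpace G] [ChartedSpace H G] [Group G] [LieGroup 𝓘(ℝ, H) ∞ G]
  [MulAction G M] [ContMDiffSMul 𝓘(ℝ, H) 𝓘(ℝ, E) ∞ G M]

/-- The interior product `ι(v_x)` with the generator of `x`. -/
noncomputable def interiorGen (x : GroupLieAlgebra 𝓘(ℝ, H) G) {k : ℕ} (σ : Form E M (k + 1)) :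
    Form E M k :=
  ⟨rawInterior (generator x) σ.1, σ.2.interior (isSmoothField_generator x)⟩

/-- The Lie derivative along the generator of `x`, defined by Cartan's formula `ι d + d ι`;
on functions only the first term is present. -/
noncomputable def lieGen (x : GroupLieAlgebra 𝓘(ℝ, H) G) : ∀ {k : ℕ}, Form E M k → Form E M k
  | 0, σ => interiorGen x (dR E M 0 σ)
  | k + 1, σ => interiorGen x (dR E M (k + 1) σ) + dR E M k (interiorGen x σ)

lemma differentiableAt_localRep_of_mem {k : ℕ} (σ : Form E M k) {p : M} {y : E}
    (hy : y ∈ (extChartAt 𝓘(ℝ, E) p).target) : DifferentiableAt ℝ (localRep p σ.1) y :=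
  ((σ.2 p).contDiffAt ((isOpen_extChartAt_target p).mem_nhds hy)).differentiableAt (by simp)

lemma localRep_interiorGen_eventuallyEq (x : GroupLieAlgebra 𝓘(ℝ, H) G) {k : ℕ}
    (σ : Form E M (k + 1)) {p : M} {y : E} (hy : y ∈ (extChartAt 𝓘(ℝ, E) p).target) :
    localRep p (interiorGen x σ).1 =ᶠ[𝓝 y]
      fun z ↦ (localRep p σ.1 z).curryLeft (fieldRep p (generator (E := E) x) z) := by
  filter_upwards [(isOpen_extChartAt_target p).mem_nhds hy] with z hz
  exact localRep_rawInterior hz _ σ.1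

lemma localRep_lieGen (x : GroupLieAlgebra 𝓘(ℝ, H) G) {k : ℕ} (σ : Form E M k) {p : M} {y : E}
    (hy : y ∈ (extChartAt 𝓘(ℝ, E) p).target) (u : Fin k → E) :
    localRep p (lieGen x σ).1 y u =
      lieRep (fieldRep p (generator (E := E) x)) (localRep p σ.1) y u := by
  have h1 : ∀ {k : ℕ} (σ : Form E M k) (u : Fin k → E),
      localRep p (interiorGen x (dR E M k σ)).1 y u =
        extDeriv (localRep p σ.1) y (Matrix.vecCons (fieldRep p (generator (E := E) x) y) u) := by
    intro k σ u
    rw [(localRep_interiorGen_eventuallyEq x _ hy).self_of_nhds]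
    change localRep p (rawExtDeriv σ.1) y _ = _
    rw [localRep_rawExtDeriv σ.2 hy]
    rfl
  cases k with
  | zero =>
    exact (h1 σ u).trans
      (extDeriv_zero_vecCons (differentiableAt_localRep_of_mem σ hy) _ u)
  | succ k =>
    rw [← extDeriv_vecCons_add (differentiableAt_localRep_of_mem σ hy)
      ((isSmoothField_generator x).differentiableAt_fieldRep hy), ← h1]
    change localRep p (interiorGen x (dR E M (k + 1) σ)).1 y u +
      localRep p (rawExtDeriv (interiorGen x σ).1) y u = _
    rw [localRep_rawExtDeriv (interiorGen x σ).2 hy,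
      (localRep_interiorGen_eventuallyEq x σ hy).extDeriv_eq]

lemma form_ext_localRep {k : ℕ} {σ η : Form E M k}
    (h : ∀ p (u : Fin k → E), localRep p σ.1 (extChartAt 𝓘(ℝ, E) p p) u =
      localRep p η.1 (extChartAt 𝓘(ℝ, E) p p) u) : σ = η :=
  Subtype.ext <| rawForm_ext_localRep fun p ↦ ContinuousAlternatingMap.ext (h p)

/-- `L_{v_x} ι(v_y) = ι(v_y) L_{v_x} + ι(v_{[x, y]})`. -/
lemma lieGen_interiorGen [CompleteSpace H] (x y : GroupLieAlgebra 𝓘(ℝ, H) G) {k : ℕ}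
    (σ : Form E M (k + 1)) :
    lieGen x (interiorGen y σ) = interiorGen y (lieGen x σ) + interiorGen ⁅x, y⁆ σ := by
  refine form_ext_localRep fun p u ↦ ?_
  have hp := mem_extChartAt_target (I := 𝓘(ℝ, E)) p
  rw [localRep_lieGen x _ hp, lieRep_congr (localRep_interiorGen_eventuallyEq y σ hp),
    lieRep_curryLeft (differentiableAt_localRep_of_mem σ hp)
      ((isSmoothField_generator y).differentiableAt_fieldRep hp), lieBracket_fieldRep_generator,
    ← localRep_lieGen x σ hp]
  change _ = localRep p (interiorGen y (lieGen x σ)).1 _ u + localRep p (interiorGen ⁅x, y⁆ σ).1 _ u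
  rw [(localRep_interiorGen_eventuallyEq y (lieGen x σ) hp).self_of_nhds,
    (localRep_interiorGen_eventuallyEq ⁅x, y⁆ σ hp).self_of_nhds]
  rfl

/-- The derivative at the identity of the inverse of the preferred chart there is the identity. -/
lemma mfderiv_extChartAt_one_symm :
    mfderiv 𝓘(ℝ, H) 𝓘(ℝ, H) (extChartAt 𝓘(ℝ, H) (1 : G)).symm (extChartAt 𝓘(ℝ, H) (1 : G) 1) =
      ContinuousLinearMap.id ℝ H := by
  have h := mfderivWithin_range_extChartAt_symm (I := 𝓘(ℝ, H)) (x := (1 : G))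
  rwa [ModelWithCorners.range_eq_univ, mfderivWithin_univ] at h

/-- Invariant forms are annihilated by the Lie derivatives along generators. In place of the
exponential, the curve `γ(t) = ψ⁻¹(ψ(1) + t x)` in a chart `ψ` at the identity is used. -/
lemma lieGen_eq_zero_of_invariant (x : GroupLieAlgebra 𝓘(ℝ, H) G) {k : ℕ} (σ : Form E M k)
    (hσ : ∀ g : G, rawPullback (fun p : M ↦ g • p) σ.1 = σ.1) : lieGen x σ = 0 := by
  refine form_ext_localRep fun p u ↦ ?_
  have hp := mem_extChartAt_target (I := 𝓘(ℝ, E)) p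
  rw [localRep_lieGen x _ hp]
  change _ = (0 : ℝ)
  set φ := extChartAt 𝓘(ℝ, E) p
  set ψ := extChartAt 𝓘(ℝ, H) (1 : G)
  -- the tangent vector `x`, read as an element of the model space
  let x' : H := x
  let γ : ℝ → G := fun t ↦ ψ.symm (ψ 1 + t • x')
  have hψ1 : ψ 1 ∈ ψ.target := mem_extChartAt_target (I := 𝓘(ℝ, H)) (1 : G)
  have hγ0 : γ 0 = 1 := by
    simp only [γ, zero_smul, add_zero]
    exact ψ.left_inv (mem_extChartAt_source (I := 𝓘(ℝ, H)) (1 : G))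
  have hlin : HasFDerivAt (fun t : ℝ ↦ ψ 1 + t • x')
      ((ContinuousLinearMap.id ℝ ℝ).smulRight x') 0 := by
    simpa using ((hasFDerivAt_id (𝕜 := ℝ) (0 : ℝ)).smul_const x').const_add (ψ 1)
  have hlinC : ContDiff ℝ ∞ (fun t : ℝ ↦ ψ 1 + t • x') := by fun_prop
  have hψs : ContMDiffAt 𝓘(ℝ, H) 𝓘(ℝ, H) ∞ ψ.symm (ψ 1 + (0 : ℝ) • x') := by
    rw [zero_smul, add_zero]
    exact mdiff_chart_symm hψ1
  have hγ : ContMDiffAt 𝓘(ℝ, ℝ) 𝓘(ℝ, H) ∞ γ 0 :=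
    ContMDiffAt.comp (g := ψ.symm) (f := fun t : ℝ ↦ ψ 1 + t • x') 0 hψs hlinC.contMDiff.contMDiffAt
  have hγd : (mfderiv 𝓘(ℝ, ℝ) 𝓘(ℝ, H) γ 0 (1 : ℝ) : H) = x := by
    have h1 : mfderiv 𝓘(ℝ, ℝ) 𝓘(ℝ, H) γ 0 =
        (mfderiv 𝓘(ℝ, H) 𝓘(ℝ, H) ψ.symm (ψ 1 + (0 : ℝ) • x')).comp
          (mfderiv 𝓘(ℝ, ℝ) 𝓘(ℝ, H) (fun t : ℝ ↦ ψ 1 + t • x') 0) :=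
      mfderiv_comp (0 : ℝ) (hψs.mdifferentiableAt (by simp))
        (hlinC.contMDiff.contMDiffAt.mdifferentiableAt (by simp))
    have h2 : ∀ z : H, z = ψ 1 → ∀ v : H, (mfderiv 𝓘(ℝ, H) 𝓘(ℝ, H) ψ.symm z v : H) = v := by
      rintro _ rfl v
      exact DFunLike.congr_fun mfderiv_extChartAt_one_symm v
    have h3 : (mfderiv 𝓘(ℝ, ℝ) 𝓘(ℝ, H) (fun t : ℝ ↦ ψ 1 + t • x') 0 (1 : ℝ) : H) = x' := by
      rw [mfderiv_eq_fderiv, hlin.fderiv]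
      exact one_smul ℝ x'
    refine (DFunLike.congr_fun h1 (1 : ℝ)).trans ?_
    exact (h2 _ (by rw [zero_smul, add_zero]) _).trans h3
  let Φ : ℝ × E → E := fun q ↦ φ ((γ q.1)⁻¹ • φ.symm q.2)
  -- the action in the chart, before applying `φ`
  have hA {y : E} (hy : y ∈ φ.target) : ContMDiffAt 𝓘(ℝ, ℝ × E) 𝓘(ℝ, E) ∞
      (fun q : ℝ × E ↦ (γ q.1)⁻¹ • φ.symm q.2) (0, y) := by
    have h1 : ContMDiffAt 𝓘(ℝ, ℝ × E) 𝓘(ℝ, H) ∞ (fun q : ℝ × E ↦ γ q.1) (0, y) :=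
      ContMDiffAt.comp (g := γ) (f := fun q : ℝ × E ↦ q.1) (0, y) hγ
        contDiff_fst.contMDiff.contMDiffAt
    have h2 : ContMDiffAt 𝓘(ℝ, ℝ × E) 𝓘(ℝ, E) ∞ (fun q : ℝ × E ↦ φ.symm q.2) (0, y) :=
      ContMDiffAt.comp (g := φ.symm) (f := fun q : ℝ × E ↦ q.2) (0, y) (mdiff_chart_symm hy)
        contDiff_snd.contMDiff.contMDiffAt
    exact ContMDiffAt.smul h1.inv h2
  have hA0 (y : E) : (γ 0)⁻¹ • φ.symm y = φ.symm y := by rw [hγ0, inv_one, one_smul]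
  have hΦC {y : E} (hy : y ∈ φ.target) : ContDiffAt ℝ ∞ Φ (0, y) := by
    refine contMDiffAt_iff_contDiffAt.1 <| ContMDiffAt.comp (I' := 𝓘(ℝ, E)) (g := φ)
      (f := fun q : ℝ × E ↦ (γ q.1)⁻¹ • φ.symm q.2) _ (mdiff_chart ?_) (hA hy)
    simp only [hA0]
    exact φ.map_target hy
  have hΦ0 {y : E} (hy : y ∈ φ.target) : Φ (0, y) = y := by
    simp only [Φ, hA0]
    exact φ.right_inv hy
  have htar : ∀ᶠ y in 𝓝 (φ p), y ∈ φ.target := (isOpen_extChartAt_target p).mem_nhds hp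
  have hsrc {y : E} (hy : y ∈ φ.target) : ∀ᶠ t : ℝ in 𝓝 0, (γ t)⁻¹ • φ.symm y ∈ φ.source := by
    have h1 : ContinuousAt (fun t : ℝ ↦ (γ t)⁻¹ • φ.symm y) 0 :=
      ContinuousAt.comp (g := fun q : ℝ × E ↦ (γ q.1)⁻¹ • φ.symm q.2) (f := fun t : ℝ ↦ (t, y))
        (hA hy).continuousAt (by fun_prop)
    refine h1 ((isOpen_extChartAt_source p).mem_nhds ?_)
    simp only [hA0]
    exact φ.map_target hy
  refine lieRep_eq_zero_of_pullback_eq (Φ := Φ) (hΦC hp) (htar.mono fun y hy ↦ hΦ0 hy) ?_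
    (differentiableAt_localRep_of_mem σ hp) ?_ u
  · filter_upwards [htar] with y hy
    let q : M := φ.symm y
    let o : G → M := fun g ↦ g⁻¹ • q
    have ho : ContMDiff 𝓘(ℝ, H) 𝓘(ℝ, E) ∞ o :=
      ContMDiff.smul (I := 𝓘(ℝ, H)) contMDiff_id.inv contMDiff_const
    let c : ℝ → E := fun t ↦ Φ (t, y)
    have hc : HasFDerivAt c ((fderiv ℝ Φ (0, y)).comp (ContinuousLinearMap.inl ℝ ℝ E)) 0 :=
      HasFDerivAt.comp (g := Φ) 0 ((hΦC hy).differentiableAt (by simp)).hasFDerivAt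
        (hasFDerivAt_prodMk_left 0 y)
    have hc0 : c 0 = y := hΦ0 hy
    have hc0' : c 0 ∈ φ.target := by rw [hc0]; exact hy
    have hev : φ.symm ∘ c =ᶠ[𝓝 0] o ∘ γ := (hsrc hy).mono fun t ht ↦ φ.left_inv ht
    have key : (mfderiv 𝓘(ℝ, E) 𝓘(ℝ, E) φ.symm (c 0)).comp (mfderiv 𝓘(ℝ, ℝ) 𝓘(ℝ, E) c 0) =
        (mfderiv 𝓘(ℝ, H) 𝓘(ℝ, E) o (γ 0)).comp (mfderiv 𝓘(ℝ, ℝ) 𝓘(ℝ, H) γ 0) := by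
      rw [← mfderiv_comp (0 : ℝ) ((mdiff_chart_symm hc0').mdifferentiableAt (by simp))
          hc.differentiableAt.mdifferentiableAt,
        ← mfderiv_comp (0 : ℝ) ((ho _).mdifferentiableAt (by simp))
          (hγ.mdifferentiableAt (by simp))]
      exact hev.mfderiv_eq
    have h1 : (mfderiv 𝓘(ℝ, ℝ) 𝓘(ℝ, E) c 0 (1 : ℝ) : E) = fderiv ℝ Φ (0, y) (1, 0) := by
      rw [mfderiv_eq_fderiv, hc.fderiv]
      rfl
    -- `c 0 = y` and `γ 0 = 1` only propositionally: tangent spaces are read as copies of `E`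
    -- and `H` when base points are changed
    have h2 : ∀ z : E, z = y → ∀ v : E, (mfderiv 𝓘(ℝ, E) 𝓘(ℝ, E) φ.symm y v : E) =
        mfderiv 𝓘(ℝ, E) 𝓘(ℝ, E) φ.symm z v := by
      rintro _ rfl v
      rfl
    have h3 : ∀ g : G, g = 1 → ∀ v : H,
        (mfderiv 𝓘(ℝ, H) 𝓘(ℝ, E) o g v : E) = mfderiv 𝓘(ℝ, H) 𝓘(ℝ, E) o 1 v := by
      rintro _ rfl v
      rfl
    -- it suffices to compare the images under the derivative of `φ⁻¹`
    apply (isInv hy).injective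
    refine (mfderiv_symm_fieldRep hy _).trans ?_
    rw [← h1]
    refine Eq.trans ?_ (h2 _ hc0 _).symm
    refine Eq.trans ?_ (DFunLike.congr_fun key (1 : ℝ)).symm
    refine Eq.trans ?_ (h3 _ hγ0 _).symm
    exact congrArg (mfderiv 𝓘(ℝ, H) 𝓘(ℝ, E) o 1) hγd.symm
  · filter_upwards [hsrc hp] with t ht
    have hg : ContMDiff 𝓘(ℝ, E) 𝓘(ℝ, E) ∞ (fun q : M ↦ (γ t)⁻¹ • q) :=
      ContMDiffSMul.contMDiff_const_smul (I := 𝓘(ℝ, H)) _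
    have h1 := localRep_pullback hg σ.1 hp ht
    rw [hσ] at h1
    exact h1

end Cartan

/-! ### Iterated contractions with generators -/

section Cone

variable {E : Type*} [NormedAddCommGroup E] [NormedSpace ℝ E] [FiniteDimensional ℝ E]
  {M : Type*} [TopologicalSpace M] [ChartedSpace E M] [IsManifold 𝓘(ℝ, E) ∞ M]
  {H : Type*} [NormedAddCommGroup H] [NormedSpace ℝ H] [FiniteDimensional ℝ H]
  {G : Type*} [TopologicalSpace G] [ChartedSpace H G] [Group G] [LieGroup 𝓘(ℝ, H) ∞ G]
  [MulAction G M] [ContMDiffSMul 𝓘(ℝ, H) 𝓘(ℝ, E) ∞ G M]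

lemma contractForm_add {k j N : ℕ} (h : j + k = N) (σ τ : Form E M N) :
    contractForm H G h (σ + τ) = contractForm H G h σ + contractForm H G h τ := by
  subst h
  exact map_add _ σ τ

lemma contractForm_sub {k j N : ℕ} (h : j + k = N) (σ τ : Form E M N) :
    contractForm H G h (σ - τ) = contractForm H G h σ - contractForm H G h τ := by
  subst h
  exact map_sub _ σ τ

lemma contractForm_zero_right {k j N : ℕ} (h : j + k = N) :
    contractForm H G h (0 : Form E M N) = 0 := by
  subst h
  exact map_zero _

lemma contractForm_zero {j : ℕ} (σ : Form E M j) (x : Fin 0 → GroupLieAlgebra 𝓘(ℝ, H) G) :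
    contractForm H G (j := j) rfl σ x = σ :=
  rfl

lemma contractForm_vecCons {k j N : ℕ} (h : j + (k + 1) = N + 1) (h' : j + k = N)
    (σ : Form E M (N + 1)) (a : GroupLieAlgebra 𝓘(ℝ, H) G)
    (u : Fin k → GroupLieAlgebra 𝓘(ℝ, H) G) :
    contractForm H G h σ (Matrix.vecCons a u) = contractForm H G h' (interiorGen a σ) u := by
  subst h'
  rfl

lemma curryLeft_contractForm {k j N : ℕ} (h : j + (k + 1) = N + 1) (h' : j + k = N)
    (σ : Form E M (N + 1)) (a : GroupLieAlgebra 𝓘(ℝ, H) G) :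
    (contractForm H G h σ).curryLeft a = contractForm H G h' (interiorGen a σ) :=
  AlternatingMap.ext fun u ↦ contractForm_vecCons h h' σ a u

lemma interiorGen_neg (x : GroupLieAlgebra 𝓘(ℝ, H) G) {k : ℕ} (σ : Form E M (k + 1)) :
    interiorGen (-x) σ = -interiorGen x σ := by
  -- `ι(v_x) σ` is linear in `x`, being the value at `x` of the alternating map `σ_1`
  have h := fun a : GroupLieAlgebra 𝓘(ℝ, H) G ↦
    contractForm_vecCons (H := H) (G := G) (j := k) rfl rfl σ a (fun i : Fin 0 ↦ i.elim0)
  have h' := (contractForm H G (j := k) (k := 1) rfl σ).map_vecCons_smul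
    (fun i : Fin 0 ↦ i.elim0) (-1) x
  rwa [h, h, contractForm_zero, contractForm_zero, neg_smul, neg_smul, one_smul, one_smul] at h'

lemma interiorGen_dR (x : GroupLieAlgebra 𝓘(ℝ, H) G) {k : ℕ} (σ : Form E M (k + 1)) :
    interiorGen x (dR E M (k + 1) σ) = lieGen x σ - dR E M k (interiorGen x σ) :=
  (add_sub_cancel_right _ _).symm

variable (H G) in
/-- The alternating map `x ↦ d (ι(v_{x₁} ∧ ⋯ ∧ v_{xₖ}) σ)` with values in `j`-forms, for a form `σ`
of degree `N = j + k - 1`; for `j = 0` there is nothing to differentiate, and the map is zero. -/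
noncomputable def dContract {N k : ℕ} (σ : Form E M N) :
    ∀ j : ℕ, j + k = N + 1 → GroupLieAlgebra 𝓘(ℝ, H) G [⋀^Fin k]→ₗ[ℝ] Form E M j
  | 0, _ => 0
  | j + 1, h => (dR E M j).compAlternatingMap (contractForm H G (by omega) σ)

lemma dContract_vecCons {N k j : ℕ} (h : j + (k + 1) = N + 1 + 1) (h' : j + k = N + 1)
    (σ : Form E M (N + 1)) (a : GroupLieAlgebra 𝓘(ℝ, H) G)
    (u : Fin k → GroupLieAlgebra 𝓘(ℝ, H) G) :
    dContract H G σ j h (Matrix.vecCons a u) = dContract H G (interiorGen a σ) j h' u := by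
  cases j with
  | zero => rfl
  | succ j => exact congrArg (dR E M j) (contractForm_vecCons _ _ σ a u)

/-- Cartan's formula for several generators and an arbitrary form `τ`:
`ι(v_{x₀} ∧ ⋯ ∧ v_{xₖ}) dτ = (-1)^{k+1} d ι(v_{x₀} ∧ ⋯ ∧ v_{xₖ}) τ - (d_𝔤 τ_k)(x₀, …, xₖ)
  + ∑ i, (-1)^i ι(v_{x₀} ∧ ⋯ v̂_{xᵢ} ⋯ ∧ v_{xₖ}) L_{v_{xᵢ}} τ`. It is stated for arbitrary forms
because the induction passes from `τ` to `ι(v_{x₀}) τ`, which is not invariant if `τ` is. -/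
lemma contractForm_dR {N k j : ℕ} (h : j + (k + 1) = N + 1) (h' : j + k = N) (τ : Form E M N)
    (x : Fin (k + 1) → GroupLieAlgebra 𝓘(ℝ, H) G) :
    contractForm H G h (dR E M N τ) x =
      (-1 : ℝ) ^ (k + 1) • dContract H G τ j h x -
        ceD (GroupLieAlgebra 𝓘(ℝ, H) G) (Form E M j) k (contractForm H G h' τ) x +
      ∑ i : Fin (k + 1), (-1 : ℝ) ^ (i : ℕ) •
        contractForm H G h' (lieGen (x i) τ) (i.removeNth x) := by
  obtain ⟨a, u, rfl⟩ : ∃ a u, x = Matrix.vecCons a u :=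
    ⟨x 0, Fin.tail x, (Fin.cons_self_tail x).symm⟩
  induction k generalizing N a with
  | zero =>
    subst h'
    rw [contractForm_vecCons h rfl]
    simp only [contractForm_zero]
    rw [Fin.sum_univ_succ]
    cases j with
    | zero => simp [ceD, dContract, lieGen]
    | succ j =>
      have h1 : dContract H G τ (j + 1) h (Matrix.vecCons a u) = dR E M j (interiorGen a τ) :=
        congrArg (dR E M j) (contractForm_vecCons rfl rfl τ a u)
      simp [ceD, h1, lieGen]
  | succ k ih =>
    obtain ⟨N, rfl⟩ : ∃ N', N = N' + 1 := ⟨j + k, by omega⟩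
    have h'' : j + k = N := by omega
    obtain ⟨b, v, hu⟩ : ∃ b v, u = Matrix.vecCons b v :=
      ⟨u 0, Fin.tail u, (Fin.cons_self_tail u).symm⟩
    have h1 := ih h' h'' (interiorGen a τ) b v
    rw [← hu] at h1
    have h2 : ceD (GroupLieAlgebra 𝓘(ℝ, H) G) (Form E M j) (k + 1) (contractForm H G h' τ)
        (Matrix.vecCons a u) =
        -(∑ i : Fin (k + 1), (-1 : ℝ) ^ (i : ℕ) •
          contractForm H G h' τ (Matrix.vecCons ⁅a, u i⁆ (i.removeNth u))) -
        ceD (GroupLieAlgebra 𝓘(ℝ, H) G) (Form E M j) k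
          (contractForm H G h'' (interiorGen a τ)) u := by
      have h3 := DFunLike.congr_fun (curryLeft_ceD_succ a (contractForm H G h' τ)) u
      rw [AlternatingMap.sub_apply, AlternatingMap.neg_apply, ceAct_apply, derivSum_eq,
        curryLeft_contractForm h' h''] at h3
      exact h3
    have h3 (i : Fin (k + 1)) : contractForm H G h'' (lieGen (u i) (interiorGen a τ))
          (i.removeNth u) =
        contractForm H G h' (lieGen (u i) τ) (Matrix.vecCons a (i.removeNth u)) -
          contractForm H G h' τ (Matrix.vecCons ⁅a, u i⁆ (i.removeNth u)) := by
      rw [lieGen_interiorGen, contractForm_add, AlternatingMap.add_apply,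
        contractForm_vecCons h' h'', contractForm_vecCons h' h'', ← lie_skew, interiorGen_neg,
        ← zero_sub, contractForm_sub, contractForm_zero_right, AlternatingMap.sub_apply,
        AlternatingMap.zero_apply]
      abel
    have h4 (i : Fin (k + 1)) : i.succ.removeNth (Matrix.vecCons a u) =
        Matrix.vecCons a (i.removeNth u) := by
      funext l
      induction l using Fin.cases with
      | zero => simp [Fin.removeNth, Matrix.vecCons]
      | succ l => simp [Fin.removeNth, Matrix.vecCons]
    have h5 : ∑ i : Fin (k + 1 + 1), (-1 : ℝ) ^ (i : ℕ) • contractForm H G h'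
          (lieGen ((Matrix.vecCons a u : Fin (k + 1 + 1) → GroupLieAlgebra 𝓘(ℝ, H) G) i) τ)
          (i.removeNth (Matrix.vecCons a u)) =
        contractForm H G h' (lieGen a τ) u - ∑ i : Fin (k + 1), (-1 : ℝ) ^ (i : ℕ) •
          contractForm H G h' (lieGen (u i) τ) (Matrix.vecCons a (i.removeNth u)) := by
      rw [Fin.sum_univ_succ, sub_eq_add_neg, ← Finset.sum_neg_distrib]
      congr 1
      · rw [Fin.val_zero, pow_zero, one_smul]
        rfl
      · refine Finset.sum_congr rfl fun i _ ↦ ?_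
        rw [h4, Fin.val_succ, pow_succ, mul_neg_one, neg_smul]
        rfl
    rw [contractForm_vecCons h h', interiorGen_dR, contractForm_sub, AlternatingMap.sub_apply, h1,
      h2, h5, dContract_vecCons h h', pow_succ (-1 : ℝ) (k + 1), mul_neg_one, neg_smul]
    simp only [h3, smul_sub, Finset.sum_sub_distrib]
    abel

/-- For an invariant form, `(dσ)_{k+1} = (-1)^{k+1} d σ_{k+1} - d_𝔤 σ_k`. -/
lemma contractForm_dR_of_invariant {N k j : ℕ} (h : j + (k + 1) = N + 1) (h' : j + k = N)
    (σ : InvForm E M G N) :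
    contractForm H G h (dR E M N σ.toForm) =
      (-1 : ℝ) ^ (k + 1) • dContract H G σ.toForm j h -
        ceD (GroupLieAlgebra 𝓘(ℝ, H) G) (Form E M j) k (contractForm H G h' σ.toForm) := by
  ext1 x
  rw [contractForm_dR h h']
  have h0 (y : GroupLieAlgebra 𝓘(ℝ, H) G) : lieGen y σ.toForm = 0 :=
    lieGen_eq_zero_of_invariant y σ.toForm σ.2
  simp only [h0, contractForm_zero_right, AlternatingMap.zero_apply, smul_zero,
    Finset.sum_const_zero, add_zero]
  rfl

/-! ### The cone is a complex -/

lemma dR_dR {k : ℕ} (σ : Form E M k) : dR E M (k + 1) (dR E M k σ) = 0 := by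
  refine form_ext_localRep fun p u ↦ ?_
  have hp := mem_extChartAt_target (I := 𝓘(ℝ, E)) p
  change localRep p (rawExtDeriv (dR E M k σ).1) _ u = 0
  have hev : localRep p (dR E M k σ).1 =ᶠ[𝓝 (extChartAt 𝓘(ℝ, E) p p)]
      extDeriv (localRep p σ.1) := by
    filter_upwards [(isOpen_extChartAt_target p).mem_nhds hp] with z hz
    exact localRep_rawExtDeriv σ.2 hz
  rw [localRep_rawExtDeriv (dR E M k σ).2 hp, hev.extDeriv_eq, extDeriv_extDeriv_apply
    ((σ.2 p).contDiffAt ((isOpen_extChartAt_target p).mem_nhds hp))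
    (by simpa using (ENat.LEInfty.out : (2 : ℕ∞ω) ≤ ∞))]
  rfl

lemma dCE_compAlternatingMap {L V W : Type*} [LieRing L] [LieAlgebra ℝ L] [AddCommGroup V]
    [Module ℝ V] [AddCommGroup W] [Module ℝ W] {k : ℕ} (f : V →ₗ[ℝ] W)
    (φ : L [⋀^Fin (k + 1)]→ₗ[ℝ] V) :
    dCE k (f.compAlternatingMap φ) = f.compAlternatingMap (dCE k φ) := by
  ext x
  change bracketSum (f.compAlternatingMap φ) x = f (bracketSum φ x)
  simp [bracketSum]

lemma dInvDeg_dInvDeg (n : ℤ) (σ : InvDeg E M G n) :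
    dInvDeg E M H G (n + 1) (dInvDeg E M H G n σ) = 0 := by
  funext ⟨i, h⟩
  match i, h with
  | 0, _ => rfl
  | 1, _ => exact map_zero (dInv E M H G 0)
  | i + 2, _ => exact Subtype.ext (dR_dR _)

lemma dTot_dTot (n : ℤ) (φ : TotDeg E M H G n) :
    dTot E M H G (n + 1) (dTot E M H G n φ) = 0 := by
  have h1 : dTotCE E M H G (n + 1) (dTotCE E M H G n φ) = 0 := by
    funext ⟨⟨k, j⟩, h⟩
    match k, h with
    | 0, _ => rfl
    | 1, _ => exact map_zero (dCE (L := GroupLieAlgebra 𝓘(ℝ, H) G) 0)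
    | k + 2, _ => exact ceD_ceD (k := k + 1) (φ ⟨(k, j), _⟩)
  have h2 : dTotDR E M H G (n + 1) (dTotDR E M H G n φ) = 0 := by
    funext ⟨⟨k, j⟩, h⟩
    ext1 x
    match j, h with
    | 0, _ => rfl
    | 1, _ =>
      change (-1 : ℝ) ^ (k + 1) • dR E M 0 0 = 0
      rw [map_zero, smul_zero]
    | j + 2, h =>
      change (-1 : ℝ) ^ (k + 1) • dR E M (j + 1) ((-1 : ℝ) ^ (k + 1) • dR E M j _) = 0
      rw [map_smul, dR_dR, smul_zero, smul_zero]
  have h3 : dTotCE E M H G (n + 1) (dTotDR E M H G n φ) +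
      dTotDR E M H G (n + 1) (dTotCE E M H G n φ) = 0 := by
    funext ⟨⟨k, j⟩, h⟩
    match k, j, h with
    | 0, 0, _ => exact add_zero _
    | 0, j + 1, _ =>
      change 0 + (-1 : ℝ) ^ (0 + 1) • (dR E M j).compAlternatingMap 0 = 0
      ext1 x
      simp
    | k + 1, 0, _ =>
      change dCE k 0 + 0 = (0 : _ [⋀^Fin (k + 2)]→ₗ[ℝ] Form E M 0)
      rw [map_zero, add_zero]
    | k + 1, j + 1, h =>
      change dCE k ((-1 : ℝ) ^ (k + 1) • (dR E M j).compAlternatingMap _) +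
        (-1 : ℝ) ^ (k + 1 + 1) • (dR E M j).compAlternatingMap (dCE k _) = 0
      rw [map_smul, dCE_compAlternatingMap, pow_succ (-1 : ℝ) (k + 1), mul_neg_one, neg_smul]
      exact add_neg_cancel _
  simp only [dTot, LinearMap.add_apply, map_add, h1, h2]
  rw [zero_add, add_zero]
  exact (add_comm _ _).trans h3

lemma toForm_apply_eq {n : ℤ} (σ : InvDeg E M G n) {k j N : ℕ} (h : j + k = N)
    (h₁ : ((j + k : ℕ) : ℤ) = n) (h₂ : (N : ℤ) = n) :
    contractGen H G k j (σ ⟨j + k, h₁⟩).toForm = contractForm H G h (σ ⟨N, h₂⟩).toForm := by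
  subst h
  rfl

/-- `σ ↦ σ̃` is a cochain map. -/
lemma tilde_dInvDeg (n : ℤ) (σ : InvDeg E M G n) :
    tilde E M H G (n + 1) (dInvDeg E M H G n σ) = dTot E M H G n (tilde E M H G n σ) := by
  funext ⟨⟨k, j⟩, h⟩
  have hn : ((j + k : ℕ) : ℤ) = n := by push_cast at h ⊢; omega
  have h1 := contractForm_dR_of_invariant (H := H) (N := j + k) (k := k) (j := j) rfl rfl
    (σ ⟨j + k, hn⟩)
  change (-1 : ℝ) ^ k • contractForm H G (k := k + 1) (j := j) rfl
      (dR E M (j + k) (σ ⟨j + k, hn⟩).toForm) =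
    dTotCE E M H G n (tilde E M H G n σ) ⟨(k, j), h⟩ +
      dTotDR E M H G n (tilde E M H G n σ) ⟨(k, j), h⟩
  have hCE : dTotCE E M H G n (tilde E M H G n σ) ⟨(k, j), h⟩ = -(-1 : ℝ) ^ k •
      ceD (GroupLieAlgebra 𝓘(ℝ, H) G) (Form E M j) k
        (contractForm H G (k := k) (j := j) rfl (σ ⟨j + k, hn⟩).toForm) := by
    cases k with
    | zero =>
      change 0 = -(-1 : ℝ) ^ 0 • (0 : _ [⋀^Fin 1]→ₗ[ℝ] Form E M j)
      rw [smul_zero]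
    | succ k =>
      change dCE k ((-1 : ℝ) ^ k • contractGen H G (k + 1) j _) = _
      rw [map_smul, pow_succ, mul_neg_one, neg_neg]
      rfl
  have hDR : dTotDR E M H G n (tilde E M H G n σ) ⟨(k, j), h⟩ =
      (-1 : ℝ) ^ k • (-1 : ℝ) ^ (k + 1) • dContract H G (σ ⟨j + k, hn⟩).toForm j rfl := by
    cases j with
    | zero =>
      change 0 = (-1 : ℝ) ^ k • (-1 : ℝ) ^ (k + 1) • (0 : _ [⋀^Fin (k + 1)]→ₗ[ℝ] Form E M 0)
      rw [smul_zero, smul_zero]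
    | succ j =>
      ext1 x
      change (-1 : ℝ) ^ (k + 1) • dR E M j
          ((-1 : ℝ) ^ k • contractGen H G (k + 1) j (σ ⟨j + (k + 1), _⟩).toForm x) =
        (-1 : ℝ) ^ k • (-1 : ℝ) ^ (k + 1) • dR E M j (contractForm H G _ _ x)
      rw [map_smul, smul_comm, toForm_apply_eq]
  rw [h1, hCE, hDR, smul_sub, sub_eq_add_neg, neg_smul]
  exact add_comm _ _

lemma coneD_coneD (n : ℤ) : coneD E M H G (n + 1) ∘ₗ coneD E M H G n = 0 := by
  refine LinearMap.ext fun b ↦ Prod.ext (dInvDeg_dInvDeg _ b.1) ?_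
  change tilde E M H G (n + 1 + 1) (dInvDeg E M H G (n + 1) b.1) -
    dTot E M H G (n + 1) (tilde E M H G (n + 1) b.1 - dTot E M H G n b.2) = 0
  rw [tilde_dInvDeg, map_sub, dTot_dTot, sub_zero, sub_self]

end Cone

/-! ### Closed elements of the cone and homotopy moment maps -/

lemma varsigma_succ (k : ℕ) : varsigma (k + 1) = (-1) ^ (k + 1) * varsigma k := by
  have h : (k + 1) * (k + 1 + 1) / 2 = (k + 1) + k * (k + 1) / 2 := by
    rw [show (k + 1) * (k + 1 + 1) = k * (k + 1) + (k + 1) * 2 by ring,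
      Nat.add_mul_div_right _ _ two_pos, add_comm]
  rw [varsigma, varsigma, h, pow_add]
  ring

lemma varsigma_ne_zero (k : ℕ) : varsigma k ≠ 0 :=
  neg_ne_zero.2 (pow_ne_zero _ (by norm_num))

lemma varsigma_one : varsigma 1 = 1 := by
  simp [varsigma]

section Cone

variable {E : Type*} [NormedAddCommGroup E] [NormedSpace ℝ E] [FiniteDimensional ℝ E]
  {M : Type*} [TopologicalSpace M] [ChartedSpace E M] [IsManifold 𝓘(ℝ, E) ∞ M]
  {H : Type*} [NormedAddCommGroup H] [NormedSpace ℝ H] [FiniteDimensional ℝ H]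
  {G : Type*} [TopologicalSpace G] [ChartedSpace H G] [Group G] [LieGroup 𝓘(ℝ, H) ∞ G]
  [MulAction G M] [ContMDiffSMul 𝓘(ℝ, H) 𝓘(ℝ, E) ∞ G M]

lemma invDegEquiv_symm_apply {m : ℕ} {n : ℤ} (h : (m : ℤ) = n) (σ : InvForm E M G m) :
    (invDegEquiv h).symm σ ⟨m, h⟩ = σ :=
  (invDegEquiv h).apply_symm_apply σ

lemma dInvDeg_eq_zero_iff {m : ℕ} {n : ℤ} (h : (m : ℤ) = n) (σ : InvForm E M G m) :
    dInvDeg E M H G n ((invDegEquiv h).symm σ) = 0 ↔ dR E M m σ.toForm = 0 := by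
  have key (h' : ((m + 1 : ℕ) : ℤ) = n + 1) :
      (dInvDeg E M H G n ((invDegEquiv h).symm σ) ⟨m + 1, h'⟩).toForm = dR E M m σ.toForm :=
    congrArg (fun τ : InvForm E M G m ↦ dR E M m τ.toForm) (invDegEquiv_symm_apply h σ)
  refine ⟨fun h0 ↦ ?_, fun h0 ↦ ?_⟩
  · rw [← key (by push_cast; omega), h0]
    rfl
  · funext ⟨i, hi⟩
    obtain rfl : i = m + 1 := by omega
    exact Subtype.ext ((key hi).trans h0)

variable (H) in
/-- The equation `σ̃ = d_tot φ` in the component `Λ^{k+1} 𝔤^* ⊗ Ω^j(M)`. -/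
def CompEq {n : ℕ} (σ : Form E M (n + 1)) (φ : TotDeg E M H G n) (k j : ℕ)
    (h : j + (k + 1) = n + 1) : Prop :=
  (-1 : ℝ) ^ k • contractForm H G h σ =
    dTot E M H G n φ ⟨(k, j), by exact_mod_cast h⟩

lemma tilde_eq_dTot_iff {n : ℕ} (σ : InvForm E M G (n + 1)) (φ : TotDeg E M H G n) :
    tilde E M H G (n + 1) ((invDegEquiv (Nat.cast_succ n)).symm σ) = dTot E M H G n φ ↔
      ∀ k j (h : j + (k + 1) = n + 1), CompEq H σ.toForm φ k j h := by
  have key (k j : ℕ) (h : j + (k + 1) = n + 1) :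
      tilde E M H G (n + 1) ((invDegEquiv (Nat.cast_succ n)).symm σ)
        ⟨(k, j), by exact_mod_cast h⟩ = (-1 : ℝ) ^ k • contractForm H G h σ.toForm := by
    change (-1 : ℝ) ^ k • contractGen H G (k + 1) j _ = _
    rw [toForm_apply_eq _ h _ (Nat.cast_succ n), invDegEquiv_symm_apply]
  refine ⟨fun h0 k j h ↦ (key k j h).symm.trans (congrFun h0 _), fun h0 ↦ ?_⟩
  funext ⟨⟨k, j⟩, h⟩
  exact (key k j (by exact_mod_cast h)).trans (h0 k j _)

lemma compEq_zero_zero {n : ℕ} (σ : Form E M (n + 1)) (φ : TotDeg E M H G n)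
    (h : 0 + (0 + 1) = n + 1) :
    CompEq H σ φ 0 0 h ↔ ∀ x : Fin 1 → GroupLieAlgebra 𝓘(ℝ, H) G,
      0 = varsigma (n + 1) • contractForm H G (k := 1) (j := 0) h σ x := by
  obtain rfl : n = 0 := by omega
  change (-1 : ℝ) ^ 0 • contractForm H G h σ = 0 + 0 ↔ _
  simp only [pow_zero, one_smul, add_zero, zero_add, varsigma_one]
  exact ⟨fun h0 x ↦ by rw [h0]; rfl, fun h0 ↦ AlternatingMap.ext fun x ↦ (h0 x).symm⟩

lemma compEq_zero_succ {n j : ℕ} (σ : Form E M (n + 1)) (φ : TotDeg E M H G n)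
    (h : j + 1 + (0 + 1) = n + 1) (h' : ((j + (0 + 1) : ℕ) : ℤ) = n) :
    CompEq H σ φ 0 (j + 1) h ↔ ∀ x : Fin 1 → GroupLieAlgebra 𝓘(ℝ, H) G,
      dR E M j (toMoment φ ⟨(0, j), h'⟩ x) =
        -contractForm H G (k := 1) (j := j + 1) h σ x := by
  change (-1 : ℝ) ^ 0 • contractForm H G h σ =
    0 + (-1 : ℝ) ^ (0 + 1) • (dR E M j).compAlternatingMap (φ ⟨(0, j), h'⟩) ↔
    ∀ x : Fin 1 → GroupLieAlgebra 𝓘(ℝ, H) G,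
      dR E M j (varsigma (0 + 1) • φ ⟨(0, j), h'⟩ x) = _
  rw [AlternatingMap.ext_iff]
  refine forall_congr' fun x ↦ ?_
  simp only [pow_zero, one_smul, zero_add, pow_one, neg_smul, varsigma_one,
    AlternatingMap.neg_apply, LinearMap.compAlternatingMap_apply]
  exact eq_comm.trans neg_eq_iff_eq_neg

lemma bracketSum_smul {L V : Type*} [LieRing L] [LieAlgebra ℝ L] [AddCommGroup V] [Module ℝ V]
    {k : ℕ} (c : ℝ) (φ : L [⋀^Fin (k + 1)]→ₗ[ℝ] V) (x : Fin (k + 2) → L) :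
    bracketSum (c • φ) x = c • bracketSum φ x :=
  DFunLike.congr_fun (map_smul (dCE k) c φ) x

/-- The signs in the equations for `k ≥ 2`: the relation `ς(k + 2) = (-1)^k ς(k + 1)`
turns the sign `(-1)^{k+1}` of `σ̃` into that of a homotopy moment map. -/
lemma neg_varsigma_smul_eq_iff {V : Type*} [AddCommGroup V] [Module ℝ V] (k : ℕ) (b c : V) :
    (-1 : ℝ) ^ (k + 1) • c = b ↔ -(varsigma (k + 1) • b) = varsigma (k + 2) • c := by
  have h1 : varsigma (k + 2) • c = -(varsigma (k + 1) • (-1 : ℝ) ^ (k + 1) • c) := by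
    rw [varsigma_succ, smul_smul, ← neg_smul]
    congr 1
    ring
  rw [h1, neg_inj, (smul_right_injective V (varsigma_ne_zero (k + 1))).eq_iff]
  exact eq_comm

lemma compEq_succ_zero {n k : ℕ} (σ : Form E M (n + 1)) (φ : TotDeg E M H G n)
    (h : 0 + (k + 1 + 1) = n + 1) (h' : ((0 + (k + 1) : ℕ) : ℤ) = n) :
    CompEq H σ φ (k + 1) 0 h ↔ ∀ x : Fin (k + 2) → GroupLieAlgebra 𝓘(ℝ, H) G,
      -bracketSum (toMoment φ ⟨(k, 0), h'⟩) x =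
        varsigma (n + 1) • contractForm H G (k := k + 2) (j := 0) h σ x := by
  obtain rfl : n = k + 1 := by omega
  change (-1 : ℝ) ^ (k + 1) • contractForm H G h σ = dCE k (φ ⟨(k, 0), h'⟩) + 0 ↔
    ∀ x : Fin (k + 2) → GroupLieAlgebra 𝓘(ℝ, H) G,
      -bracketSum (varsigma (k + 1) • φ ⟨(k, 0), h'⟩) x = _
  rw [AlternatingMap.ext_iff, add_zero]
  refine forall_congr' fun x ↦ ?_
  rw [bracketSum_smul]
  exact neg_varsigma_smul_eq_iff k _ _

lemma compEq_succ_succ {n k j : ℕ} (σ : Form E M (n + 1)) (φ : TotDeg E M H G n)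
    (h : j + 1 + (k + 1 + 1) = n + 1) (h₁ : ((j + 1 + (k + 1) : ℕ) : ℤ) = n)
    (h₂ : ((j + (k + 1 + 1) : ℕ) : ℤ) = n) :
    CompEq H σ φ (k + 1) (j + 1) h ↔ ∀ x : Fin (k + 2) → GroupLieAlgebra 𝓘(ℝ, H) G,
      -bracketSum (toMoment φ ⟨(k, j + 1), h₁⟩) x =
        dR E M j (toMoment φ ⟨(k + 1, j), h₂⟩ x) +
          varsigma (k + 2) • contractForm H G (k := k + 2) (j := j + 1) h σ x := by
  change (-1 : ℝ) ^ (k + 1) • contractForm H G h σ = dCE k (φ ⟨(k, j + 1), h₁⟩) +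
      (-1 : ℝ) ^ (k + 1 + 1) • (dR E M j).compAlternatingMap (φ ⟨(k + 1, j), h₂⟩) ↔
    ∀ x : Fin (k + 2) → GroupLieAlgebra 𝓘(ℝ, H) G,
      -bracketSum (varsigma (k + 1) • φ ⟨(k, j + 1), h₁⟩) x =
        dR E M j (varsigma (k + 2) • φ ⟨(k + 1, j), h₂⟩ x) + _
  rw [AlternatingMap.ext_iff]
  refine forall_congr' fun x ↦ ?_
  rw [bracketSum_smul, map_smul, ← smul_add, ← neg_varsigma_smul_eq_iff, smul_add,
    pow_succ (-1 : ℝ) (k + 1), mul_neg_one, neg_smul, ← sub_eq_add_neg, AlternatingMap.sub_apply,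
    eq_sub_iff_add_eq']
  rfl

lemma coneD_eq_zero_iff {n : ℕ} (σ : InvForm E M G (n + 1)) (φ : TotDeg E M H G n) :
    coneD E M H G n ((invDegEquiv (Nat.cast_succ n)).symm σ, φ) = 0 ↔
      dR E M (n + 1) σ.toForm = 0 ∧ IsMomentMap σ.toForm (toMoment φ) := by
  refine Prod.ext_iff.trans (and_congr (dInvDeg_eq_zero_iff _ σ) ?_)
  refine (sub_eq_zero.trans (tilde_eq_dTot_iff σ φ)).trans ⟨fun h ↦ ?_, fun h ↦ ?_⟩
  · exact
      { one := fun j hj ↦ (compEq_zero_succ _ φ _ _).1 (h 0 (j + 1) (by omega))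
        middle := fun l j hj ↦ (compEq_succ_succ _ φ _ _ _).1 (h (l + 1) (j + 1) (by omega))
        last := fun l hl ↦ (compEq_succ_zero _ φ _ _).1 (h (l + 1) 0 (by omega))
        last_zero := fun hn ↦ (compEq_zero_zero _ φ _).1 (h 0 0 (by omega)) }
  · intro k j hkj
    match k, j, hkj with
    | 0, 0, hkj => exact (compEq_zero_zero _ φ _).2 (h.last_zero (by omega))
    | 0, j + 1, hkj => exact (compEq_zero_succ _ φ _ (by omega)).2 (h.one j (by omega))
    | k + 1, 0, hkj => exact (compEq_succ_zero _ φ _ (by omega)).2 (h.last k (by omega))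
    | k + 1, j + 1, hkj =>
      exact (compEq_succ_succ _ φ _ (by omega) (by omega)).2 (h.middle k j (by omega))

end Cone

end HomotopyMoment

open HomotopyMoment
theorem mainTheorem12
    {E : Type*} [NormedAddCommGroup E] [NormedSpace ℝ E] [FiniteDimensional ℝ E]
    {M : Type*} [TopologicalSpace M] [ChartedSpace E M] [IsManifold 𝓘(ℝ, E) ∞ M]
    {H : Type*} [NormedAddCommGroup H] [NormedSpace ℝ H] [FiniteDimensional ℝ H]
    {G : Type*} [TopologicalSpace G] [ChartedSpace H G] [Group G] [LieGroup 𝓘(ℝ, H) ∞ G]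
    [MulAction G M] [ContMDiffSMul 𝓘(ℝ, H) 𝓘(ℝ, E) ∞ G M] :
    (∀ n : ℤ, coneD E M H G (n + 1) ∘ₗ coneD E M H G n = 0) ∧
    ∀ (n : ℕ) (σ : InvForm E M G (n + 1)) (φ : TotDeg E M H G n),
      coneD E M H G n ((invDegEquiv (Nat.cast_succ n)).symm σ, φ) = 0 ↔
        dR E M (n + 1) σ.toForm = 0 ∧ IsMomentMap σ.toForm (toMoment φ) :=
  ⟨coneD_coneD, fun _ ↦ coneD_eq_zero_iff⟩
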